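/- All schemes are noetherian. A ring homomorphism $A\to B$ is \emph{localizing} if it identifies $B$ with a localization $S^{-1}A$ of $A$ at a multiplicative subset $S$; it is \emph{essentially of finite type} if $B$ is a localization of a finitely generated $A$-algebra. A map $f\colon X\to Y$ of noetherian schemes is \emph{essentially of finite type} (resp. \emph{localizing}) if every $y\in Y$ has an affine open neighborhood $V=\operatorname{Spec}A$ such that $f^{-1}V$ is covered by finitely many affine opens $U_i=\operatorname{Spec}B_i$ for which all the homomorphisms $A\to B_i$ are essentially of finite type (resp. localizing). A \emph{localizing immersion} is a set-theoretically injective localizing map. Let $\mathbf{S}_e$ be the category of separated essentially finite-type maps of noetherian schemes. For $f\colon X\to Y$ and $x\in X$ let $f_x\colon \operatorname{Spec}\mathcal{O}_{X,x}\to X\to Y$ be the canonical map. Proposition. Let $\mathsf P$ be a property of maps in $\mathbf{S}_e$ such that for every map $f\colon X\to Y$ in $\mathbf{S}_e$ the following hold. $(\alpha)$ For any localizing immersion $i\colon W\to X$, if $f$ satisfies $\mathsf P$, then so does $fi$. $(\beta)$ If $f$ is of finite type, then: (i) if $f_x$ satisfies $\mathsf P$ for every $x\in X$, then so does $f$; (ii)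 the set of all points $x\in X$ such that $f_x$ satisfies $\mathsf P$ is open in $X$. Then (i) and (ii) hold for every map $f$ in $\mathbf{S}_e$, and every map $f\colon X\to Y$ in $\mathbf{S}_e$ that satisfies $\mathsf P$ factors as $X\xrightarrow{\,i\,}Z\xrightarrow{\,h\,}Y$, where $i$ is a localizing immersion and $h$ is a separated finite-type map (of noetherian schemes) satisfying $\mathsf P$. -/

import Mathlib

open CategoryTheory AlgebraicGeometry

universe u

namespace EssFiniteType

/-- A ring homomorphism `φ : A → B` is localizing if it is the canonical map to the localization
of `A` at some multiplicative subset. -/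
def IsLocalizingHom {A B : Type*} [CommRing A] [CommRing B] (φ : A →+* B) : Prop :=
  ∃ S : Submonoid A, letI := φ.toAlgebra; IsLocalization S B

/-- Every point `y` of `Y` has an affine open neighbourhood `V = Spec A` such that `f⁻¹ V` is
covered by finitely many affine opens `Uᵢ = Spec Bᵢ` for which every `A → Bᵢ` is essentially of
finite type. (It is used for noetherian schemes.) -/
def IsEssFiniteType {X Y : Scheme.{u}} (f : X ⟶ Y) : Prop :=
  ∀ y : Y, ∃ V : Y.affineOpens, y ∈ V.1 ∧ ∃ s : Set X.affineOpens, s.Finite ∧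
    (⨆ U ∈ s, U.1) = f ⁻¹ᵁ V.1 ∧
    ∀ U ∈ s, ∃ e : U.1 ≤ f ⁻¹ᵁ V.1, (f.appLE V.1 U.1 e).hom.EssFiniteType

/-- Every point `y` of `Y` has an affine open neighbourhood `V = Spec A` such that `f⁻¹ V` is
covered by finitely many affine opens `Uᵢ = Spec Bᵢ` for which every `A → Bᵢ` is a localizing
homomorphism. (It is used for noetherian schemes.) -/
def IsLocalizing {X Y : Scheme.{u}} (f : X ⟶ Y) : Prop :=
  ∀ y : Y, ∃ V : Y.affineOpens, y ∈ V.1 ∧ ∃ s : Set X.affineOpens, s.Finite ∧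
    (⨆ U ∈ s, U.1) = f ⁻¹ᵁ V.1 ∧
    ∀ U ∈ s, ∃ e : U.1 ≤ f ⁻¹ᵁ V.1, IsLocalizingHom (f.appLE V.1 U.1 e).hom

/-- A localizing immersion is a set-theoretically injective localizing map of noetherian
schemes. -/
structure IsLocalizingImmersion {X Y : Scheme.{u}} (f : X ⟶ Y) : Prop where
  noetherian_source : AlgebraicGeometry.IsNoetherian X
  noetherian_target : AlgebraicGeometry.IsNoetherian Y
  localizing : IsLocalizing f
  injective : Function.Injective f

/-- The maps of the category `Sₑ`: separated essentially finite-type maps of noetherian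
schemes. -/
structure Se {X Y : Scheme.{u}} (f : X ⟶ Y) : Prop where
  noetherian_source : AlgebraicGeometry.IsNoetherian X
  noetherian_target : AlgebraicGeometry.IsNoetherian Y
  separated : IsSeparated f
  essFiniteType : IsEssFiniteType f

/-- Maps of finite type. -/
structure IsFiniteType {X Y : Scheme.{u}} (f : X ⟶ Y) : Prop where
  locallyOfFiniteType : LocallyOfFiniteType f
  quasiCompact : QuasiCompact f

/-- The map `f_x : Spec 𝒪_{X,x} ⟶ Y`, the composite of the canonical map `Spec 𝒪_{X,x} ⟶ X`
with `f`. -/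
noncomputable def localMap {X Y : Scheme.{u}} (f : X ⟶ Y) (x : X) :
    Spec (X.presheaf.stalk x) ⟶ Y :=
  X.fromSpecStalk x ≫ f

/-- If `f_x` satisfies `P` for every `x`, then so does `f`. -/
def IsCheckedLocally (P : MorphismProperty Scheme.{u}) {X Y : Scheme.{u}} (f : X ⟶ Y) : Prop :=
  (∀ x : X, P (localMap f x)) → P f

/-- The set of points `x` such that `f_x` satisfies `P` is open. -/
def HasOpenLocus (P : MorphismProperty Scheme.{u}) {X Y : Scheme.{u}} (f : X ⟶ Y) : Prop :=
  IsOpen {x : X | P (localMap f x)}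

/-- Stability under localization, for a property of maps in `Sₑ`. -/
def IsStableUnderLocalization (P : MorphismProperty Scheme.{u}) : Prop :=
  ∀ {W X Y : Scheme.{u}} (i : W ⟶ X) (f : X ⟶ Y),
    IsLocalizingImmersion i → Se f → P f → P (i ≫ f)

end EssFiniteType

/-! ### Localizing homomorphisms and morphisms given by charts. -/

namespace EssFiniteType

/-! The heart of the matter is that every map `f` in `Sₑ` factors as a localizing immersion `i : X ⟶
Z` followed by a separated finite-type map `h : Z ⟶ Y` (`HasFactorization.of_hasCharts`). Since `i`
is flat and surjective on stalks, it induces isomorphisms on stalks, so `f_x` and `h_{i(x)}` differ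
by an isomorphism, to which `P` is insensitive by (α) (`localMap_comp_iff`). Hence the `P`-locus of
`f` is the preimage under `i` of the open `P`-locus `O` of `h`. If every `f_x` satisfies `P`, then
`i` factors through `O`; the restriction of `h` to `O` satisfies `P` by (β)(i), and then so does `f`
by (α). If `f` satisfies `P`, so does every `f_x`, because `Spec 𝒪_{X,x} ⟶ X` is a localizing
immersion.

The factorization is clear on affine charts, where an algebra essentially of finite type is a
localization of a finitely generated subalgebra. To glue factorizations of `X₁` and `X₂` through
`Z₁` and `Z₂` (`HasFactorization.of_pair`), let `W` be the schematic image of `X₁ ∩ X₂` in `Z₁ ×[Y]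
Z₂`. Both projections of `W` are isomorphisms on stalks along `X₁ ∩ X₂` (`isIso_stalkMap_of_comp`),
hence open immersions near it (`exists_isOpenImmersion_of_generalizingMap`). Separatedness of `f`
implies that only `X₁ ∩ X₂` lies over both `X₁` and `X₂` (`mem_range_of_mem_range`). After shrinking
`Z₁` and `Z₂`, what remains of `W` is open in both and closed in their product over `Y`, so gluing
along it gives a separated scheme (`exists_isSeparated_glue`). The shrinkings exist because closed
sets in noetherian schemes have finitely many generic points. -/

lemma isLocalizingHom_algebraMap {A B : Type*} [CommRing A] [CommRing B] [Algebra A B]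
    (S : Submonoid A) [h : IsLocalization S B] : IsLocalizingHom (algebraMap A B) :=
  ⟨S, by rwa [toAlgebra_algebraMap]⟩

lemma IsLocalizingHom.comp {A B C : Type*} [CommRing A] [CommRing B] [CommRing C]
    {φ : A →+* B} {ψ : B →+* C} (hφ : IsLocalizingHom φ) (hψ : IsLocalizingHom ψ) :
    IsLocalizingHom (ψ.comp φ) := by
  obtain ⟨M, hM⟩ := hφ
  obtain ⟨N, hN⟩ := hψ
  let := φ.toAlgebra
  let := ψ.toAlgebra
  let := (ψ.comp φ).toAlgebra
  have : IsScalarTower A B C := .of_algebraMap_eq' rfl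
  have : IsLocalization M B := hM
  have : IsLocalization N C := hN
  exact ⟨_, IsLocalization.localization_localization_isLocalization M N C⟩

lemma IsLocalizingHom.of_comp {A B C : Type*} [CommRing A] [CommRing B] [CommRing C]
    {φ : A →+* B} {ψ : B →+* C} (hφ : IsLocalizingHom φ) (hψ : IsLocalizingHom (ψ.comp φ)) :
    IsLocalizingHom ψ := by
  obtain ⟨M, hM⟩ := hφ
  obtain ⟨N, hN⟩ := hψ
  let := φ.toAlgebra
  let := ψ.toAlgebra
  let := (ψ.comp φ).toAlgebra
  have : IsScalarTower A B C := .of_algebraMap_eq' rfl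
  have : IsLocalization M B := hM
  have : IsLocalization N C := hN
  -- `N` need not contain `M`; the submonoid of all elements of `A` that become units in `C` does,
  -- and it gives the same localization.
  let N' : Submonoid A := (IsUnit.submonoid C).comap (algebraMap A C)
  have : IsLocalization N' C := IsLocalization.of_le N N'
    (fun x hx ↦ IsLocalization.map_units C ⟨x, hx⟩) (fun x hx ↦ hx)
  have hMN : M ≤ N' := fun x hx ↦ (IsLocalization.map_units B ⟨x, hx⟩).map ψ
  exact ⟨_, IsLocalization.isLocalization_of_submonoid_le B C M N' hMN⟩

lemma IsLocalizingHom.of_bijective {A B : Type*} [CommRing A] [CommRing B] {φ : A →+* B}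
    (h : Function.Bijective φ) : IsLocalizingHom φ := by
  let := φ.toAlgebra
  exact ⟨⊥, IsLocalization.of_le_isUnit_of_bijective (by simp [Algebra.algebraMapSubmonoid]) h⟩

lemma IsLocalizingHom.of_isIso {A B : CommRingCat.{u}} (φ : A ⟶ B) [IsIso φ] :
    IsLocalizingHom φ.hom :=
  .of_bijective (ConcreteCategory.bijective_of_isIso φ)

lemma IsLocalizingHom.essFiniteType {A B : Type*} [CommRing A] [CommRing B] {φ : A →+* B}
    (h : IsLocalizingHom φ) : φ.EssFiniteType := by
  obtain ⟨S, hS⟩ := h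
  let := φ.toAlgebra
  have : IsLocalization S B := hS
  exact Algebra.EssFiniteType.of_isLocalization B S

/-- A class of ring homomorphisms that contains the localizing ones and for which membership is
insensitive to localizing the source or the target. -/
structure LocalizationClass (Q : MorphismProperty CommRingCat.{u}) : Prop where
  of_localizing {R S : CommRingCat.{u}} (f : R ⟶ S) : IsLocalizingHom f.hom → Q f
  comp {R S T : CommRingCat.{u}} (f : R ⟶ S) (g : S ⟶ T) : Q f → Q g → Q (f ≫ g)
  of_comp {R S T : CommRingCat.{u}} (f : R ⟶ S) (g : S ⟶ T) :
    IsLocalizingHom f.hom → Q (f ≫ g) → Q g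

/-- The class of localizing homomorphisms. -/
def localizingClass : MorphismProperty CommRingCat.{u} := fun _ _ f ↦ IsLocalizingHom f.hom

/-- The class of homomorphisms essentially of finite type. -/
def essFiniteTypeClass : MorphismProperty CommRingCat.{u} := fun _ _ f ↦ f.hom.EssFiniteType

lemma localizationClass_localizing : LocalizationClass localizingClass.{u} where
  of_localizing _ h := h
  comp _ _ hf hg := hf.comp hg
  of_comp _ _ hf hfg := hf.of_comp hfg

lemma localizationClass_essFiniteType : LocalizationClass essFiniteTypeClass.{u} where
  of_localizing _ h := h.essFiniteType
  comp _ _ hf hg := RingHom.EssFiniteType.comp hf hg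
  of_comp _ _ _ hfg := RingHom.EssFiniteType.of_comp _ hfg

/-- Around every point, the morphism is given on suitable affine opens by a ring homomorphism in
the class `Q`. -/
def HasCharts (Q : MorphismProperty CommRingCat.{u}) {X Y : Scheme.{u}} (f : X ⟶ Y) : Prop :=
  ∀ x : X, ∃ (V : Y.Opens) (U : X.Opens) (e : U ≤ f ⁻¹ᵁ V),
    IsAffineOpen V ∧ IsAffineOpen U ∧ x ∈ U ∧ Q (f.appLE V U e)

lemma isLocalizingHom_map_basicOpen {X : Scheme.{u}} {U : X.Opens} (hU : IsAffineOpen U)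
    (f : Γ(X, U)) :
    IsLocalizingHom (X.presheaf.map (homOfLE (X.basicOpen_le f)).op).hom := by
  have := hU.isLocalization_basicOpen f
  exact isLocalizingHom_algebraMap (A := Γ(X, U)) (B := Γ(X, X.basicOpen f)) (.powers f)

variable {Q : MorphismProperty CommRingCat.{u}} {X Y Z : Scheme.{u}}

lemma HasCharts.exists_le (hQ : LocalizationClass Q) {f : X ⟶ Y} (hf : HasCharts Q f) (x : X)
    {V : Y.Opens} (hV : IsAffineOpen V) (hx : f x ∈ V) {N : X.Opens} (hN : x ∈ N) :
    ∃ (U : X.Opens) (e : U ≤ f ⁻¹ᵁ V), IsAffineOpen U ∧ x ∈ U ∧ U ≤ N ∧ Q (f.appLE V U e) := by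
  obtain ⟨V₀, U₀, e₀, hV₀, hU₀, hxU₀, hq⟩ := hf x
  -- A set that is basic open in both `V₀` and `V`: the target passes from `V₀` down to it by
  -- `of_comp`, then up to `V` by `comp`.
  obtain ⟨a, b, hab, hxa⟩ := exists_basicOpen_le_affine_inter hV₀ hV (f x) ⟨e₀ hxU₀, hx⟩
  obtain ⟨c, hc, hxc⟩ := hU₀.exists_basicOpen_le (V := f ⁻¹ᵁ Y.basicOpen a ⊓ N)
    ⟨x, ⟨hxa, hN⟩⟩ hxU₀
  have hcb : X.basicOpen c ≤ f ⁻¹ᵁ Y.basicOpen b := hab ▸ hc.trans inf_le_left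
  have h₁ : Q (f.appLE V₀ (X.basicOpen c) ((X.basicOpen_le c).trans e₀)) := by
    rw [← f.appLE_map e₀ (homOfLE (X.basicOpen_le c)).op]
    exact hQ.comp _ _ hq (hQ.of_localizing _ (isLocalizingHom_map_basicOpen hU₀ c))
  have h₂ : Q (f.appLE (Y.basicOpen a) (X.basicOpen c) (hc.trans inf_le_left)) := by
    refine hQ.of_comp (Y.presheaf.map (homOfLE (Y.basicOpen_le a)).op) _
      (isLocalizingHom_map_basicOpen hV₀ a) ?_
    rwa [f.map_appLE]
  have h₃ : Q (f.appLE (Y.basicOpen b) (X.basicOpen c) hcb) := by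
    have : ∀ W (hW : Y.basicOpen a = W) (h : X.basicOpen c ≤ f ⁻¹ᵁ W),
        Q (f.appLE W (X.basicOpen c) h) := by
      rintro _ rfl _; exact h₂
    exact this _ hab _
  refine ⟨X.basicOpen c, hcb.trans (f.preimage_mono (Y.basicOpen_le b)), hU₀.basicOpen c, hxc,
    hc.trans inf_le_right, ?_⟩
  rw [← f.map_appLE hcb (homOfLE (Y.basicOpen_le b)).op]
  exact hQ.comp _ _ (hQ.of_localizing _ (isLocalizingHom_map_basicOpen hV b)) h₃

lemma HasCharts.mono {Q' : MorphismProperty CommRingCat.{u}} (h : Q ≤ Q') {f : X ⟶ Y}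
    (hf : HasCharts Q f) : HasCharts Q' f := fun x ↦ by
  obtain ⟨V, U, e, hV, hU, hx, hq⟩ := hf x
  exact ⟨V, U, e, hV, hU, hx, h _ hq⟩

lemma HasCharts.comp (hQ : LocalizationClass Q) {f : X ⟶ Y} {g : Y ⟶ Z} (hf : HasCharts Q f)
    (hg : HasCharts Q g) : HasCharts Q (f ≫ g) := fun x ↦ by
  obtain ⟨V, U, e, hV, hU, hx, hq⟩ := hg (f x)
  obtain ⟨W, e', hW, hxW, -, hq'⟩ := hf.exists_le hQ x hU hx (N := ⊤) trivial
  refine ⟨V, W, e'.trans (f.preimage_mono e), hV, hW, hxW, ?_⟩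
  rw [← Scheme.Hom.appLE_comp_appLE f g V U W e e']
  exact hQ.comp _ _ hq hq'

lemma HasCharts.of_isOpenImmersion (hQ : LocalizationClass Q) (f : X ⟶ Y) [IsOpenImmersion f] :
    HasCharts Q f := fun x ↦ by
  obtain ⟨_, ⟨U, hU, rfl⟩, hxU, -⟩ :=
    X.isBasis_affineOpens.exists_subset_of_mem_open (Set.mem_univ x) isOpen_univ
  refine ⟨f ''ᵁ U, U, (f.preimage_image_eq U).ge, hU.image_of_isOpenImmersion f, hU, hxU, ?_⟩
  refine hQ.of_localizing _ ?_
  rw [← f.appIso_hom']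
  exact IsLocalizingHom.of_isIso _

lemma HasCharts.of_forall_exists_isOpenImmersion (hQ : LocalizationClass Q) (f : Y ⟶ Z)
    (h : ∀ y : Y, ∃ (X : Scheme.{u}) (j : X ⟶ Y) (x : X), IsOpenImmersion j ∧ j x = y ∧
      HasCharts Q (j ≫ f)) : HasCharts Q f := fun y ↦ by
  obtain ⟨X, j, x, _, rfl, hj⟩ := h y
  obtain ⟨V, U, e, hV, hU, hx, hq⟩ := hj x
  have e' : j ''ᵁ U ≤ f ⁻¹ᵁ V := by
    rintro _ ⟨z, hz, rfl⟩
    exact e hz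
  refine ⟨V, j ''ᵁ U, e', hV, hU.image_of_isOpenImmersion j, ⟨x, hx, rfl⟩, ?_⟩
  have : f.appLE V (j ''ᵁ U) e' = (j ≫ f).appLE V U e ≫ (j.appIso U).inv := by
    rw [Iso.eq_comp_inv, j.appIso_hom', Scheme.Hom.appLE_comp_appLE]
  rw [this]
  exact hQ.comp _ _ hq (hQ.of_localizing _ (IsLocalizingHom.of_isIso _))

lemma HasCharts.of_isAffine [IsAffine X] [IsAffine Y] (f : X ⟶ Y) (h : Q f.appTop) :
    HasCharts Q f := fun x ↦
  ⟨⊤, ⊤, le_rfl, isAffineOpen_top Y, isAffineOpen_top X, trivial, by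
    have : f.appLE ⊤ ⊤ le_rfl = f.appTop := f.appLE_eq_app
    rwa [this]⟩

/-- A morphism of schemes given locally, on source and target, by localizing homomorphisms. -/
abbrev HasLocalizingCharts (f : X ⟶ Y) : Prop := HasCharts localizingClass f

/-- On a chart the morphism is `Spec` of a ring map in `Q`, followed by an open immersion. This
reduces flatness and surjectivity on stalks to ring localizations. -/
lemma HasCharts.of_isZariskiLocalAtSource {P : MorphismProperty Scheme.{u}}
    [IsZariskiLocalAtSource P] (hP : ∀ {X Y Z : Scheme.{u}} (f : X ⟶ Y) (g : Y ⟶ Z),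
      IsOpenImmersion g → P f → P (f ≫ g))
    (hPQ : ∀ {R S : CommRingCat.{u}} (φ : R ⟶ S), Q φ → P (Spec.map φ)) {f : X ⟶ Y}
    (hf : HasCharts Q f) : P f := by
  choose V U e hV hU hx hq using hf
  rw [IsZariskiLocalAtSource.iff_of_iSup_eq_top (P := P) U
    (top_le_iff.mp fun x _ ↦ TopologicalSpace.Opens.mem_iSup.mpr ⟨x, hx x⟩)]
  intro x
  rw [← (hU x).isoSpec_hom_fromSpec, Category.assoc,
    ← IsAffineOpen.SpecMap_appLE_fromSpec f (hV x) (hU x) (e x),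
    MorphismProperty.cancel_left_of_respectsIso P]
  exact hP _ _ inferInstance (hPQ _ (hq x))

lemma HasLocalizingCharts.flat {f : X ⟶ Y} (hf : HasLocalizingCharts f) : Flat f := by
  have : IsZariskiLocalAtSource @Flat.{u} := HasRingHomProperty.instIsZariskiLocalAtSource
  refine hf.of_isZariskiLocalAtSource (P := @Flat) (fun f g _ _ ↦ inferInstance)
    fun φ ⟨S, hS⟩ ↦ ?_
  let := φ.hom.toAlgebra
  rw [HasRingHomProperty.Spec_iff (P := @Flat)]
  exact IsLocalization.flat _ S

lemma HasLocalizingCharts.surjectiveOnStalks {f : X ⟶ Y} (hf : HasLocalizingCharts f) :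
    SurjectiveOnStalks f := by
  have : IsZariskiLocalAtSource @SurjectiveOnStalks.{u} :=
    HasRingHomProperty.instIsZariskiLocalAtSource
  refine hf.of_isZariskiLocalAtSource (P := @SurjectiveOnStalks) (fun f g _ _ ↦ inferInstance)
    fun φ ⟨S, hS⟩ ↦ ?_
  let := φ.hom.toAlgebra
  rw [SurjectiveOnStalks.Spec_iff]
  exact RingHom.surjectiveOnStalks_of_isLocalization S _

/-- A flat local homomorphism is faithfully flat, hence injective. -/
lemma isIso_stalkMap_of_flat_of_surjectiveOnStalks (f : X ⟶ Y) [Flat f] [SurjectiveOnStalks f]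
    (x : X) : IsIso (f.stalkMap x) := by
  rw [ConcreteCategory.isIso_iff_bijective]
  refine ⟨?_, f.stalkMap_surjective x⟩
  algebraize [(f.stalkMap x).hom]
  have : Module.FaithfullyFlat (Y.presheaf.stalk (f x)) (X.presheaf.stalk x) :=
    @Module.FaithfullyFlat.of_flat_of_isLocalHom _ _ _ _ _ _ _
      (Flat.stalkMap f x) (f.toLRSHom.prop x)
  exact FaithfulSMul.algebraMap_injective (Y.presheaf.stalk (f x)) (X.presheaf.stalk x)

/-! ### Generic points in noetherian sober spaces. -/

/-- In a noetherian sober space, a closed set consists of the specializations of finitely many of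
its points. -/
lemma exists_finite_generic_points {α : Type*} [TopologicalSpace α] [QuasiSober α]
    [TopologicalSpace.NoetherianSpace α] {C : Set α} (hC : IsClosed C) :
    ∃ F : Set α, F.Finite ∧ F ⊆ C ∧ ∀ x ∈ C, ∃ η ∈ F, η ⤳ x := by
  obtain ⟨S, hSf, hSc, hSi, rfl⟩ :=
    TopologicalSpace.NoetherianSpace.exists_finite_set_isClosed_irreducible hC
  have hg (t : S) : IsGenericPoint (hSi t t.2).genericPoint (t : Set α) :=
    (hSi t t.2).isGenericPoint_genericPoint (hSc t t.2)
  have := hSf.to_subtype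
  refine ⟨Set.range fun t : S ↦ (hSi t t.2).genericPoint, Set.finite_range _, ?_, ?_⟩
  · rintro _ ⟨t, rfl⟩
    exact ⟨t, t.2, (hg t).mem⟩
  · rintro x ⟨t, ht, hx⟩
    exact ⟨_, ⟨⟨t, ht⟩, rfl⟩, (hg ⟨t, ht⟩).specializes hx⟩

/-- An injective generalizing map from a noetherian space is an embedding. -/
lemma isEmbedding_of_injective_of_generalizingMap {α β : Type*} [TopologicalSpace α]
    [TopologicalSpace β] [QuasiSober α] [TopologicalSpace.NoetherianSpace α] {f : α → β}
    (hc : Continuous f) (hi : Function.Injective f) (hf : GeneralizingMap f) :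
    Topology.IsEmbedding f := by
  refine ⟨⟨TopologicalSpace.ext_isClosed fun C ↦ ?_⟩, hi⟩
  rw [isClosed_induced_iff]
  refine ⟨fun hC ↦ ?_, fun ⟨D, hD, h⟩ ↦ h ▸ hD.preimage hc⟩
  obtain ⟨F, hF, hFC, h⟩ := exists_finite_generic_points hC
  -- Finiteness of `F` makes this union closed.
  refine ⟨⋃ η ∈ F, closure {f η}, hF.isClosed_biUnion fun _ _ ↦ isClosed_closure, ?_⟩
  ext x
  simp only [Set.mem_preimage, Set.mem_iUnion, exists_prop]
  refine ⟨fun ⟨η, hη, hx⟩ ↦ ?_, fun hx ↦ ?_⟩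
  -- The generization `f η` of `f x` lifts to a generization of `x`, which is `η` by injectivity.
  · obtain ⟨ξ, hξ, hξη⟩ := hf (specializes_iff_mem_closure.mpr hx)
    rw [hi hξη] at hξ
    exact hξ.mem_closed hC (hFC hη)
  · obtain ⟨η, hη, hηx⟩ := h x hx
    exact ⟨η, hη, (hηx.map hc).mem_closure⟩

/-- Let `C` be closed in a noetherian sober space mapping to `β₁` and `β₂`, and let `A₁` and `A₂`
be stable under generization. If no point of `C` lies over `A₁` and `A₂`, then the same holds for
open neighbourhoods of `A₁` and `A₂`. -/
lemma exists_open_disjoint_of_stableUnderGeneralization {α β₁ β₂ : Type*} [TopologicalSpace α]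
    [TopologicalSpace β₁] [TopologicalSpace β₂] [QuasiSober α]
    [TopologicalSpace.NoetherianSpace α] {p₁ : α → β₁} {p₂ : α → β₂} (h₁ : Continuous p₁)
    (h₂ : Continuous p₂) {A₁ : Set β₁} {A₂ : Set β₂} (hA₁ : StableUnderGeneralization A₁)
    (hA₂ : StableUnderGeneralization A₂) {C : Set α} (hC : IsClosed C)
    (h : ∀ x ∈ C, p₁ x ∈ A₁ → p₂ x ∉ A₂) :
    ∃ (U₁ : TopologicalSpace.Opens β₁) (U₂ : TopologicalSpace.Opens β₂),
      A₁ ⊆ U₁ ∧ A₂ ⊆ U₂ ∧ ∀ x ∈ C, p₁ x ∈ U₁ → p₂ x ∉ U₂ := by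
  obtain ⟨F, hF, hFC, hx⟩ := exists_finite_generic_points hC
  -- Remove the closures of the images of those generic points of `C` that miss `Aᵢ`. Stability
  -- under generization keeps `Aᵢ` inside, and a point of `C` over both open sets would specialize
  -- from a generic point over `A₁` and `A₂`.
  refine ⟨⟨(⋃ η ∈ {η ∈ F | p₁ η ∉ A₁}, closure {p₁ η})ᶜ, ?_⟩,
    ⟨(⋃ η ∈ {η ∈ F | p₂ η ∉ A₂}, closure {p₂ η})ᶜ, ?_⟩, ?_, ?_, ?_⟩
  · exact ((hF.subset (Set.sep_subset _ _)).isClosed_biUnion fun _ _ ↦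
      isClosed_closure).isOpen_compl
  · exact ((hF.subset (Set.sep_subset _ _)).isClosed_biUnion fun _ _ ↦
      isClosed_closure).isOpen_compl
  · intro a ha ha'
    obtain ⟨η, hη, hηa⟩ := Set.mem_iUnion₂.mp ha'
    exact hη.2 (hA₁ (specializes_iff_mem_closure.mpr hηa) ha)
  · intro a ha ha'
    obtain ⟨η, hη, hηa⟩ := Set.mem_iUnion₂.mp ha'
    exact hη.2 (hA₂ (specializes_iff_mem_closure.mpr hηa) ha)
  · intro x hxC hx₁ hx₂
    obtain ⟨η, hη, hηx⟩ := hx x hxC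
    have k₁ : p₁ η ∈ A₁ := by
      by_contra hn
      exact hx₁ (Set.mem_iUnion₂.mpr ⟨η, ⟨hη, hn⟩, (hηx.map h₁).mem_closure⟩)
    have k₂ : p₂ η ∈ A₂ := by
      by_contra hn
      exact hx₂ (Set.mem_iUnion₂.mpr ⟨η, ⟨hη, hn⟩, (hηx.map h₂).mem_closure⟩)
    exact h η (hFC hη) k₁ k₂

lemma isPreimmersion_of_flat [IsNoetherian X] (f : X ⟶ Y) [Flat f] [SurjectiveOnStalks f]
    (hi : Function.Injective f) : IsPreimmersion f where
  isEmbedding :=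
    isEmbedding_of_injective_of_generalizingMap f.continuous hi (Flat.generalizingMap f)

end EssFiniteType

/-! ### From isomorphisms on stalks to open immersions. -/

namespace EssFiniteType

open Limits TopologicalSpace

variable {P W X Y Z : Scheme.{u}}

lemma isNoetherian_of_finiteType (f : X ⟶ Y) [LocallyOfFiniteType f] [QuasiCompact f]
    [AlgebraicGeometry.IsNoetherian Y] : AlgebraicGeometry.IsNoetherian X where
  toIsLocallyNoetherian := LocallyOfFiniteType.isLocallyNoetherian f
  toCompactSpace := QuasiCompact.compactSpace_of_compactSpace f

lemma isNoetherian_of_isOpenImmersion (f : X ⟶ Y) [IsOpenImmersion f]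
    [AlgebraicGeometry.IsNoetherian Y] : AlgebraicGeometry.IsNoetherian X :=
  isNoetherian_of_finiteType f

/-- A morphism locally of finite type between locally noetherian schemes that induces an
isomorphism on the stalks at a point is an open immersion around this point. -/
lemma exists_isOpenImmersion_of_isIso_stalkMap (g : W ⟶ Z) [LocallyOfFiniteType g]
    [IsLocallyNoetherian Z] (w : W) [IsIso (g.stalkMap w)] :
    ∃ N : W.Opens, w ∈ N ∧ IsOpenImmersion (N.ι ≫ g) := by
  have : IsLocallyNoetherian W := LocallyOfFiniteType.isLocallyNoetherian g
  -- The inverse of the stalk map spreads out to a section `s` of `g` near `g w`.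
  obtain ⟨U, hU, s, hs, hsg⟩ := spread_out_of_isGermInjective' (𝟙 Z) g
    (Spec.map (inv (g.stalkMap w)) ≫ W.fromSpecStalk w) (x := g w) (by
      rw [Category.assoc, ← Scheme.SpecMap_stalkMap_fromSpecStalk, ← Spec.map_comp_assoc]
      simp)
  have hwU : w ∈ g ⁻¹ᵁ U := hU
  let gU : (g ⁻¹ᵁ U).toScheme ⟶ U := g ∣_ U
  have hgU : gU ≫ U.ι = (g ⁻¹ᵁ U).ι ≫ g := morphismRestrict_ι g U
  -- `gU ≫ s` agrees with the inclusion on the local scheme at `w`, hence on a neighbourhood `N₁` of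
  -- `w`.
  have key : (g ⁻¹ᵁ U).fromSpecStalkOfMem w hwU ≫ (g ⁻¹ᵁ U).ι =
      (g ⁻¹ᵁ U).fromSpecStalkOfMem w hwU ≫ gU ≫ s := by
    have : (g ⁻¹ᵁ U).fromSpecStalkOfMem w hwU ≫ gU =
        Spec.map (g.stalkMap w) ≫ U.fromSpecStalkOfMem (g w) hU := by
      rw [← cancel_mono U.ι, Category.assoc, hgU, Scheme.Opens.fromSpecStalkOfMem_ι_assoc,
        Category.assoc, Scheme.Opens.fromSpecStalkOfMem_ι, Scheme.SpecMap_stalkMap_fromSpecStalk]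
    rw [reassoc_of% this, ← hs, ← Spec.map_comp_assoc]
    simp
  let w' : (g ⁻¹ᵁ U).toScheme := ⟨w, hwU⟩
  replace key : (g ⁻¹ᵁ U).toScheme.fromSpecStalk w' ≫ (g ⁻¹ᵁ U).ι =
      (g ⁻¹ᵁ U).toScheme.fromSpecStalk w' ≫ gU ≫ s := by
    refine (cancel_epi (Spec.map (inv ((g ⁻¹ᵁ U).ι.stalkMap w')))).mp ?_
    simp only [Scheme.Opens.fromSpecStalkOfMem, Category.assoc] at key
    exact key
  obtain ⟨N₁, hN₁, hNeq⟩ := spread_out_unique_of_isGermInjective' _ _ key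
  let k : N₁.toScheme ⟶ W := N₁.ι ≫ (g ⁻¹ᵁ U).ι
  let a : N₁.toScheme ⟶ U := N₁.ι ≫ gU
  have hak : a ≫ s = k := by simp only [a, k, Category.assoc, hNeq]
  have hag : a ≫ U.ι = k ≫ g := by simp only [a, k, Category.assoc, hgU]
  -- Over `U'` the section lands in `N₁`, so the map `b` induced by `s` inverts the map `a'` induced
  -- by `g`.
  let U' : U.toScheme.Opens := s ⁻¹ᵁ k.opensRange
  let a' : N₁.toScheme ⟶ U' := IsOpenImmersion.lift U'.ι a (by
    rintro _ ⟨x, rfl⟩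
    simp only [Scheme.Opens.range_ι]
    exact ⟨x, by rw [← hak]; rfl⟩)
  let b : U'.toScheme ⟶ N₁ := IsOpenImmersion.lift k (U'.ι ≫ s) (by
    rintro _ ⟨x, rfl⟩
    exact x.2)
  have ha' : a' ≫ U'.ι = a := IsOpenImmersion.lift_fac _ _ _
  have hb : b ≫ k = U'.ι ≫ s := IsOpenImmersion.lift_fac _ _ _
  have ha'' : a' ≫ U'.ι ≫ U.ι = k ≫ g := by rw [← Category.assoc, ha', hag]
  have : IsIso a' := by
    refine ⟨b, ?_, ?_⟩
    · rw [← cancel_mono k, Category.assoc, hb, reassoc_of% ha', hak, Category.id_comp]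
    · rw [← cancel_mono U'.ι, ← cancel_mono U.ι, Category.assoc, Category.assoc, ha'',
        reassoc_of% hb, hsg]
      simp
  have : IsOpenImmersion a := by rw [← ha']; infer_instance
  have : IsOpenImmersion (k ≫ g) := by rw [← hag]; infer_instance
  refine ⟨k.opensRange, ⟨⟨⟨w, hwU⟩, hN₁⟩, rfl⟩, ?_⟩
  rw [← Scheme.Hom.isoOpensRange_inv_comp k, Category.assoc]
  infer_instance

lemma property_of_isLocalIso (Q : MorphismProperty Scheme.{u}) [IsZariskiLocalAtSource Q]
    (hQ : ∀ {X Y : Scheme.{u}} (f : X ⟶ Y), IsOpenImmersion f → Q f) (g : W ⟶ Z)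
    [h : IsLocalIso g] : Q g := by
  choose N hN hg using h.exists_isOpenImmersion
  rw [IsZariskiLocalAtSource.iff_of_iSup_eq_top (P := Q) N
    (top_le_iff.mp fun x _ ↦ Opens.mem_iSup.mpr ⟨x, hN x⟩)]
  exact fun x ↦ hQ _ (hg x)

/-- Injectivity and surjectivity on stalks give a monomorphism, and a flat monomorphism locally of
finite presentation is an open immersion. Everything but injectivity is local on the source. -/
lemma isOpenImmersion_of_isLocalIso (g : W ⟶ Z) [IsLocalIso g] [IsLocallyNoetherian Z]
    (h : Function.Injective g) : IsOpenImmersion g := by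
  have : Flat g := by
    have : IsZariskiLocalAtSource @Flat.{u} := HasRingHomProperty.instIsZariskiLocalAtSource
    exact property_of_isLocalIso @Flat (fun _ _ ↦ inferInstance) g
  have : LocallyOfFinitePresentation g := by
    have : IsZariskiLocalAtSource @LocallyOfFinitePresentation.{u} :=
      HasRingHomProperty.instIsZariskiLocalAtSource
    exact property_of_isLocalIso @LocallyOfFinitePresentation (fun _ _ ↦ inferInstance) g
  have : SurjectiveOnStalks g := by
    have : IsZariskiLocalAtSource @SurjectiveOnStalks.{u} :=
      HasRingHomProperty.instIsZariskiLocalAtSource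
    exact property_of_isLocalIso @SurjectiveOnStalks (fun _ _ ↦ inferInstance) g
  have : Mono g := SurjectiveOnStalks.mono_of_injective h
  exact IsOpenImmersion.of_flat_of_mono g

lemma isOpenImmersion_diagonal_of_isLocalIso (g : W ⟶ Z) [IsLocalIso g] :
    IsOpenImmersion (pullback.diagonal g) := by
  have : FormallyUnramified g := by
    have : IsZariskiLocalAtSource @FormallyUnramified.{u} :=
      HasRingHomProperty.instIsZariskiLocalAtSource
    exact property_of_isLocalIso @FormallyUnramified (fun _ _ ↦ inferInstance) g
  have : LocallyOfFiniteType g := by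
    have : IsZariskiLocalAtSource @LocallyOfFiniteType.{u} :=
      HasRingHomProperty.instIsZariskiLocalAtSource
    exact property_of_isLocalIso @LocallyOfFiniteType (fun _ _ ↦ inferInstance) g
  infer_instance

/-- If `N ⟶ W ⟶ Z` is a monomorphism, then a point of `W ×[Z] W` both of whose projections lie in
`N` is on the diagonal. -/
lemma mem_range_diagonal_of_mono (g : W ⟶ Z) (n : X ⟶ W) [Mono (n ≫ g)]
    (x : ↥(pullback g g)) (h₁ : pullback.fst g g x ∈ Set.range n)
    (h₂ : pullback.snd g g x ∈ Set.range n) : x ∈ Set.range (pullback.diagonal g) := by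
  have hx : x ∈ Set.range (pullback.map (n ≫ g) (n ≫ g) g g n n (𝟙 Z) (by simp) (by simp)) := by
    rw [Scheme.Pullback.range_map]
    exact ⟨h₁, h₂⟩
  obtain ⟨y, rfl⟩ := hx
  have : pullback.map (n ≫ g) (n ≫ g) g g n n (𝟙 Z) (by simp) (by simp) =
      pullback.fst _ _ ≫ n ≫ pullback.diagonal g := by
    have : pullback.fst (n ≫ g) (n ≫ g) = pullback.snd (n ≫ g) (n ≫ g) := by
      rw [← cancel_mono (n ≫ g), pullback.condition]
    apply pullback.hom_ext
    · refine (pullback.lift_fst _ _ _).trans ?_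
      simp only [Category.assoc, pullback.diagonal_fst]
      exact congr_arg _ (Category.comp_id _).symm
    · refine (pullback.lift_snd _ _ _).trans ?_
      simp only [Category.assoc, pullback.diagonal_snd, this]
      exact congr_arg _ (Category.comp_id _).symm
  rw [this]
  exact ⟨n (pullback.fst (n ≫ g) (n ≫ g) y), rfl⟩

/-- A morphism of finite type between noetherian schemes that is an isomorphism on stalks
along the image of `q` is an open immersion around this image, if its composition with `q` is
injective and generalizing. -/
lemma exists_isOpenImmersion_of_generalizingMap (q : P ⟶ W) (g : W ⟶ Z) [LocallyOfFiniteType g]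
    [AlgebraicGeometry.IsNoetherian W] [IsLocallyNoetherian Z] (hgen : GeneralizingMap (q ≫ g))
    (hinj : Function.Injective (q ≫ g)) (hst : ∀ x, IsIso (g.stalkMap (q x))) :
    ∃ G : W.Opens, Set.range q ⊆ G ∧ IsOpenImmersion (G.ι ≫ g) := by
  choose N hqN hN using fun x ↦ exists_isOpenImmersion_of_isIso_stalkMap g (q x)
  have hNinj (x : P) (a b : W) (ha : a ∈ N x) (hb : b ∈ N x) (hab : g a = g b) : a = b :=
    congr_arg Subtype.val (((N x).ι ≫ g).injective (a₁ := ⟨a, ha⟩) (a₂ := ⟨b, hb⟩) hab)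
  -- A generization is lifted along `q ≫ g`; the lift and the original point both lie in some `N x`,
  -- where `g` is injective.
  have hstable : StableUnderGeneralization (Set.range q) := by
    rintro _ w hw ⟨x, rfl⟩
    obtain ⟨x', hx', hgx'⟩ := hgen (hw.map g.continuous)
    refine ⟨x', hNinj x _ _ ?_ ?_ hgx'⟩
    · exact (hx'.map q.continuous).mem_open (N x).2 (hqN x)
    · exact hw.mem_open (N x).2 (hqN x)
  let G₀ : W.Opens := ⨆ x, N x
  have hqG₀ (x : P) : q x ∈ G₀ := Opens.mem_iSup.mpr ⟨x, hqN x⟩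
  let g₀ : G₀.toScheme ⟶ Z := G₀.ι ≫ g
  have hg₀ : IsLocalIso g₀ := ⟨fun x ↦ by
    obtain ⟨y, hy⟩ := Opens.mem_iSup.mp x.2
    have := hN y
    let l : (N y).toScheme ⟶ G₀ := W.homOfLE (le_iSup N y)
    have hl : l ≫ G₀.ι = (N y).ι := W.homOfLE_ι _
    have : IsOpenImmersion (l ≫ g₀) := by rwa [← Category.assoc, hl]
    refine ⟨l.opensRange, ⟨⟨x.1, hy⟩, G₀.ι.injective congr($hl ⟨x.1, hy⟩)⟩, ?_⟩
    rw [← Scheme.Hom.isoOpensRange_inv_comp l, Category.assoc]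
    infer_instance⟩
  have := isOpenImmersion_diagonal_of_isLocalIso g₀
  have : AlgebraicGeometry.IsNoetherian (pullback g₀ g₀) :=
    have := isNoetherian_of_isOpenImmersion G₀.ι
    isNoetherian_of_finiteType (pullback.fst g₀ g₀)
  have hcond (z : ↥(pullback g₀ g₀)) :
      g (G₀.ι (pullback.fst g₀ g₀ z)) = g (G₀.ι (pullback.snd g₀ g₀ z)) :=
    congr($(pullback.condition (f := g₀) (g := g₀)) z)
  -- The local isomorphism `g₀` has an open diagonal, so its complement is a closed set, which has
  -- to be kept away from pairs of points of `U₁` and `U₂`.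
  obtain ⟨U₁, U₂, h₁, h₂, h⟩ := exists_open_disjoint_of_stableUnderGeneralization
    (α := ↥(pullback g₀ g₀)) (pullback.fst g₀ g₀ ≫ G₀.ι).continuous
    (pullback.snd g₀ g₀ ≫ G₀.ι).continuous hstable hstable
    (C := (Set.range (pullback.diagonal g₀))ᶜ)
    (pullback.diagonal g₀).isOpenEmbedding.isOpen_range.isClosed_compl (by
      rintro z hz ⟨x, hx⟩ ⟨y, hy⟩
      apply hz
      replace hx : q x = G₀.ι (pullback.fst g₀ g₀ z) := hx
      replace hy : q y = G₀.ι (pullback.snd g₀ g₀ z) := hy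
      -- Both projections of `z` are now the same point `q x`, and `g` is a monomorphism on the
      -- single neighbourhood `N x`.
      obtain rfl : x = y := hinj (by
        rw [Scheme.Hom.comp_apply, Scheme.Hom.comp_apply, hx, hy, hcond])
      have := hN x
      let l : (N x).toScheme ⟶ G₀ := W.homOfLE (le_iSup N x)
      have hl : l ≫ G₀.ι = (N x).ι := W.homOfLE_ι _
      have : Mono (l ≫ g₀) := by rw [← Category.assoc, hl]; infer_instance
      refine mem_range_diagonal_of_mono g₀ l z ?_ ?_
      · exact ⟨⟨q x, hqN x⟩, G₀.ι.injective (congr($hl ⟨q x, hqN x⟩).trans hx)⟩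
      · exact ⟨⟨q x, hqN x⟩, G₀.ι.injective (congr($hl ⟨q x, hqN x⟩).trans hy)⟩)
  refine ⟨G₀ ⊓ U₁ ⊓ U₂, ?_, ?_⟩
  · rintro _ ⟨x, rfl⟩
    exact ⟨⟨hqG₀ x, h₁ ⟨x, rfl⟩⟩, h₂ ⟨x, rfl⟩⟩
  · let l : (G₀ ⊓ U₁ ⊓ U₂).toScheme ⟶ G₀ := W.homOfLE (inf_le_left.trans inf_le_left)
    have hl : l ≫ G₀.ι = (G₀ ⊓ U₁ ⊓ U₂).ι := W.homOfLE_ι _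
    rw [← hl, Category.assoc]
    change IsOpenImmersion (l ≫ g₀)
    have : IsLocalIso (l ≫ g₀) := ⟨fun x ↦ by
      obtain ⟨U, hxU, hU⟩ := hg₀.exists_isOpenImmersion (l x)
      refine ⟨l ⁻¹ᵁ U, hxU, ?_⟩
      rw [← Category.assoc, ← morphismRestrict_ι, Category.assoc]
      infer_instance⟩
    have hla (a : (G₀ ⊓ U₁ ⊓ U₂).toScheme) : G₀.ι (l a) = a.1 := congr($hl a)
    refine isOpenImmersion_of_isLocalIso _ fun a b hab ↦ ?_
    -- Two points with the same image form a point of the fibre product, which by the choice of `U₁`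
    -- and `U₂` is on the diagonal.
    obtain ⟨z, hz₁, hz₂⟩ :=
      Scheme.Pullback.exists_preimage_pullback (f := g₀) (g := g₀) (l a) (l b) hab
    have hz : z ∈ Set.range (pullback.diagonal g₀) := by
      by_contra hz
      refine h z hz ?_ ?_
      · rw [Scheme.Hom.comp_apply, hz₁]
        exact (hla a).symm ▸ a.2.1.2
      · rw [Scheme.Hom.comp_apply, hz₂]
        exact (hla b).symm ▸ b.2.2
    obtain ⟨c, rfl⟩ := hz
    rw [← Scheme.Hom.comp_apply, pullback.diagonal_fst] at hz₁
    rw [← Scheme.Hom.comp_apply, pullback.diagonal_snd] at hz₂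
    exact l.injective (hz₁.symm.trans hz₂)

end EssFiniteType

/-! ### Separated gluing of two schemes along an open subscheme. -/

namespace EssFiniteType

open Limits

variable {W X X₁ X₂ Y Z Z₁ Z₂ : Scheme.{u}}

section TwoElementCover

variable (j₁ : X₁ ⟶ X) (j₂ : X₂ ⟶ X) [IsOpenImmersion j₁] [IsOpenImmersion j₂]

/-- The open cover given by two jointly surjective open immersions. -/
noncomputable def coverOfPair (hj : ∀ x, x ∈ Set.range j₁ ∨ x ∈ Set.range j₂) :
    X.OpenCover where
  I₀ := ULift.{u} Bool
  X b := b.down.rec X₁ X₂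
  f b := match b with
    | ⟨false⟩ => j₁
    | ⟨true⟩ => j₂
  mem₀ := by
    rw [Scheme.presieve₀_mem_precoverage_iff]
    refine ⟨fun x ↦ (hj x).elim (fun h ↦ ⟨⟨false⟩, h⟩) (fun h ↦ ⟨⟨true⟩, h⟩), ?_⟩
    rintro ⟨_ | _⟩ <;> assumption

lemma hom_ext_of_pair (hj : ∀ x, x ∈ Set.range j₁ ∨ x ∈ Set.range j₂) {f g : X ⟶ Z}
    (h₁ : j₁ ≫ f = j₁ ≫ g) (h₂ : j₂ ≫ f = j₂ ≫ g) : f = g := by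
  refine Scheme.Cover.hom_ext (coverOfPair j₁ j₂ hj) _ _ ?_
  rintro ⟨_ | _⟩
  exacts [h₁, h₂]

lemma exists_desc_of_pair (hj : ∀ x, x ∈ Set.range j₁ ∨ x ∈ Set.range j₂)
    (f₁ : X₁ ⟶ Z) (f₂ : X₂ ⟶ Z) (h : pullback.fst j₁ j₂ ≫ f₁ = pullback.snd j₁ j₂ ≫ f₂) :
    ∃ f : X ⟶ Z, j₁ ≫ f = f₁ ∧ j₂ ≫ f = f₂ := by
  let φ (b : (coverOfPair j₁ j₂ hj).I₀) : (coverOfPair j₁ j₂ hj).X b ⟶ Z := match b with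
    | ⟨false⟩ => f₁
    | ⟨true⟩ => f₂
  have hφ : ∀ a b, pullback.fst ((coverOfPair j₁ j₂ hj).f a) ((coverOfPair j₁ j₂ hj).f b) ≫ φ a =
      pullback.snd _ _ ≫ φ b := by
    rintro ⟨_ | _⟩ ⟨_ | _⟩
    · have : pullback.fst j₁ j₁ = pullback.snd j₁ j₁ := by
        rw [← cancel_mono j₁, pullback.condition]
      exact congr($this ≫ f₁)
    · exact h
    · have h' : pullback.fst j₂ j₁ ≫ f₂ = pullback.snd j₂ j₁ ≫ f₁ := by
        rw [← cancel_epi (pullbackSymmetry j₁ j₂).hom]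
        simp [h]
      exact h'
    · have : pullback.fst j₂ j₂ = pullback.snd j₂ j₂ := by
        rw [← cancel_mono j₂, pullback.condition]
      exact congr($this ≫ f₂)
  exact ⟨(coverOfPair j₁ j₂ hj).glueMorphisms φ hφ,
    (coverOfPair j₁ j₂ hj).ι_glueMorphisms φ hφ ⟨false⟩,
    (coverOfPair j₁ j₂ hj).ι_glueMorphisms φ hφ ⟨true⟩⟩

end TwoElementCover

/-- A morphism is separated if the range of the diagonal is closed locally on an open cover of
the fibre product by products of open subschemes of the source. -/
lemma isSeparated_of_isClosed_preimage (h : Z ⟶ Y)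
    (H : ∀ z z' : Z, ∃ (A B : Scheme.{u}) (k : A ⟶ Z) (l : B ⟶ Z) (_ : IsOpenImmersion k)
      (_ : IsOpenImmersion l), z ∈ Set.range k ∧ z' ∈ Set.range l ∧
      IsClosed (Set.range (pullback.mapDesc k l h))) : IsSeparated h := by
  have hcl : IsClosed (Set.range (pullback.diagonal h)) := by
    rw [← isOpen_compl_iff, isOpen_iff_forall_mem_open]
    intro t ht
    obtain ⟨A, B, k, l, _, _, hk, hl, hcl⟩ := H (pullback.fst h h t) (pullback.snd h h t)
    let m := pullback.map (k ≫ h) (l ≫ h) h h k l (𝟙 _) (by simp) (by simp)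
    have hmt : t ∈ Set.range m := by
      rw [Scheme.Pullback.range_map]
      exact ⟨hk, hl⟩
    obtain ⟨t', rfl⟩ := hmt
    -- `A ×[Z] B ⟶ A ×[Y] B` is the base change of the diagonal along the open immersion `m`, so `m`
    -- carries the complement of its range off the diagonal.
    have sq : IsPullback (pullback.fst k l ≫ k) (pullback.mapDesc k l h) (pullback.diagonal h) m :=
      pullback_map_diagonal_isPullback k l h
    refine ⟨m '' (Set.range (pullback.mapDesc k l h))ᶜ, ?_,
      m.isOpenEmbedding.isOpenMap _ hcl.isOpen_compl, t', ?_, rfl⟩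
    · rintro _ ⟨s, hs, rfl⟩ ⟨z, hz⟩
      obtain ⟨p, -, hp⟩ := Scheme.exists_preimage_of_isPullback sq z s hz
      exact hs ⟨p, hp⟩
    · rintro ⟨p, rfl⟩
      exact ht ⟨_, congr($sq.w p)⟩
  exact ⟨IsClosedImmersion.of_isPreimmersion _ hcl⟩

/-- The range of `A ×[Z] B ⟶ A ×[Y] B` is closed if it is the closed range of `W ⟶ A ×[Y] B`. -/
lemma isClosed_range_mapDesc {A B : Scheme.{u}} (k : A ⟶ Z) (l : B ⟶ Z) [IsOpenImmersion k]
    (h : Z ⟶ Y) (a : W ⟶ A) (b : W ⟶ B) (hab : a ≫ k = b ≫ l)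
    (H : ∀ x y, k x = l y → ∃ w, b w = y)
    (hcl : IsClosed (Set.range (pullback.lift (f := k ≫ h) (g := l ≫ h) a b
      (by rw [reassoc_of% hab])))) : IsClosed (Set.range (pullback.mapDesc k l h)) := by
  have hw : pullback.lift a b hab ≫ pullback.mapDesc k l h =
      pullback.lift (f := k ≫ h) (g := l ≫ h) a b (by rw [reassoc_of% hab]) := by
    apply pullback.hom_ext
    · rw [pullback.lift_fst, Category.assoc]
      exact (congr_arg _ ((pullback.lift_fst _ _ _).trans (Category.comp_id _))).trans
        (pullback.lift_fst _ _ _)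
    · rw [pullback.lift_snd, Category.assoc]
      exact (congr_arg _ ((pullback.lift_snd _ _ _).trans (Category.comp_id _))).trans
        (pullback.lift_snd _ _ _)
  rw [← hw] at hcl
  convert hcl using 1
  refine subset_antisymm ?_ ?_
  · rintro _ ⟨p, rfl⟩
    obtain ⟨w, hw⟩ := H (pullback.fst k l p) (pullback.snd k l p)
      congr($(pullback.condition (f := k) (g := l)) p)
    refine ⟨w, ?_⟩
    rw [Scheme.Hom.comp_apply]
    congr 1
    apply (pullback.snd k l).injective
    rw [← hw, ← Scheme.Hom.comp_apply, pullback.lift_snd]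
  · rintro _ ⟨w, rfl⟩
    exact ⟨_, rfl⟩

/-- `Z ×[Y] Z` is covered by four products: the two squares are settled by separatedness of the
pieces, the two mixed ones by `hcl` and its image under the swap. -/
lemma isSeparated_of_pair (k₁ : Z₁ ⟶ Z) (k₂ : Z₂ ⟶ Z) [IsOpenImmersion k₁] [IsOpenImmersion k₂]
    (hk : ∀ z, z ∈ Set.range k₁ ∨ z ∈ Set.range k₂) (a₁ : W ⟶ Z₁) (a₂ : W ⟶ Z₂)
    (ha : a₁ ≫ k₁ = a₂ ≫ k₂) (H : ∀ z₁ z₂, k₁ z₁ = k₂ z₂ → ∃ w, a₁ w = z₁ ∧ a₂ w = z₂)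
    (h : Z ⟶ Y) [IsSeparated (k₁ ≫ h)] [IsSeparated (k₂ ≫ h)]
    (hcl : IsClosed (Set.range (pullback.lift (f := k₁ ≫ h) (g := k₂ ≫ h) a₁ a₂
      (by rw [reassoc_of% ha])))) : IsSeparated h := by
  have hd {A : Scheme.{u}} (k : A ⟶ Z) [IsOpenImmersion k] [IsSeparated (k ≫ h)] :
      IsClosed (Set.range (pullback.mapDesc k k h)) :=
    isClosed_range_mapDesc k k h (𝟙 A) (𝟙 A) rfl (fun x y _ ↦ ⟨y, rfl⟩)
      (pullback.diagonal (k ≫ h)).isClosedEmbedding.isClosed_range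
  refine isSeparated_of_isClosed_preimage h fun z z' ↦ ?_
  obtain hz | hz := hk z <;> obtain hz' | hz' := hk z'
  · exact ⟨_, _, k₁, k₁, ‹_›, ‹_›, hz, hz', hd k₁⟩
  · exact ⟨_, _, k₁, k₂, ‹_›, ‹_›, hz, hz', isClosed_range_mapDesc k₁ k₂ h a₁ a₂ ha
      (fun x y hxy ↦ (H x y hxy).imp fun _ ↦ And.right) hcl⟩
  · refine ⟨_, _, k₂, k₁, ‹_›, ‹_›, hz, hz', isClosed_range_mapDesc k₂ k₁ h a₂ a₁ ha.symm
      (fun x y hxy ↦ (H y x hxy.symm).imp fun _ ↦ And.left) ?_⟩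
    have : pullback.lift (f := k₁ ≫ h) (g := k₂ ≫ h) a₁ a₂ (by rw [reassoc_of% ha]) ≫
        (pullbackSymmetry _ _).hom = pullback.lift a₂ a₁ (by rw [reassoc_of% ha]) := by
      apply pullback.hom_ext
      · rw [Category.assoc, pullbackSymmetry_hom_comp_fst, pullback.lift_snd, pullback.lift_fst]
      · rw [Category.assoc, pullbackSymmetry_hom_comp_snd, pullback.lift_snd, pullback.lift_fst]
    rw [← this]
    have hr := Set.range_comp (pullbackSymmetry (k₁ ≫ h) (k₂ ≫ h)).hom
      (pullback.lift (f := k₁ ≫ h) (g := k₂ ≫ h) a₁ a₂ (by rw [reassoc_of% ha]))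
    refine hr ▸ ?_
    exact (pullbackSymmetry (k₁ ≫ h) (k₂ ≫ h)).hom.homeomorph.isClosedMap _ hcl
  · exact ⟨_, _, k₂, k₂, ‹_›, ‹_›, hz, hz', hd k₂⟩

/-- Gluing of two separated schemes over `Y` along a common open subscheme `W` that is closed in
their fibre product. -/
lemma exists_isSeparated_pushout (a₁ : W ⟶ Z₁) (a₂ : W ⟶ Z₂) [IsOpenImmersion a₁]
    [IsOpenImmersion a₂] (h₁ : Z₁ ⟶ Y) (h₂ : Z₂ ⟶ Y) [IsSeparated h₁] [IsSeparated h₂]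
    (ha : a₁ ≫ h₁ = a₂ ≫ h₂) (hcl : IsClosed (Set.range (pullback.lift a₁ a₂ ha))) :
    ∃ (Z : Scheme.{u}) (k₁ : Z₁ ⟶ Z) (k₂ : Z₂ ⟶ Z) (h : Z ⟶ Y), IsOpenImmersion k₁ ∧
      IsOpenImmersion k₂ ∧ (∀ z, z ∈ Set.range k₁ ∨ z ∈ Set.range k₂) ∧ a₁ ≫ k₁ = a₂ ≫ k₂ ∧
      (∀ z₁ z₂, k₁ z₁ = k₂ z₂ → ∃ w, a₁ w = z₁ ∧ a₂ w = z₂) ∧ k₁ ≫ h = h₁ ∧ k₂ ≫ h = h₂ ∧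
      IsSeparated h := by
  let F : WidePushoutShape WalkingPair ⥤ Scheme.{u} := span a₁ a₂
  have hF : ∀ {i j : WidePushoutShape WalkingPair} (f : i ⟶ j), IsOpenImmersion (F.map f) := by
    rintro _ _ (_ | (_ | _))
    · rw [WidePushoutShape.hom_id, F.map_id]
      infer_instance
    · exact inferInstanceAs (IsOpenImmersion a₁)
    · exact inferInstanceAs (IsOpenImmersion a₂)
  have : HasColimit (span a₁ a₂) := inferInstanceAs (HasColimit F)
  let k₁ : Z₁ ⟶ pushout a₁ a₂ := pushout.inl a₁ a₂
  let k₂ : Z₂ ⟶ pushout a₁ a₂ := pushout.inr a₁ a₂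
  have hk₁ : IsOpenImmersion k₁ := inferInstanceAs (IsOpenImmersion (colimit.ι F (some .left)))
  have hk₂ : IsOpenImmersion k₂ := inferInstanceAs (IsOpenImmersion (colimit.ι F (some .right)))
  have hk : ∀ z, z ∈ Set.range k₁ ∨ z ∈ Set.range k₂ := by
    intro z
    obtain ⟨_ | _ | _, x, hx⟩ := Scheme.IsLocallyDirected.ι_jointly_surjective F z
    · refine .inl ⟨a₁ x, ?_⟩
      exact congr($(colimit.w F (WidePushoutShape.Hom.init WalkingPair.left)) x).trans hx
    · exact .inl ⟨x, hx⟩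
    · exact .inr ⟨x, hx⟩
  have H : ∀ z₁ z₂, k₁ z₁ = k₂ z₂ → ∃ w, a₁ w = z₁ ∧ a₂ w = z₂ := by
    intro z₁ z₂ hz
    obtain ⟨_, f, g, x, hf, hg⟩ := (Scheme.IsLocallyDirected.ι_eq_ι_iff F
      (i := some .left) (j := some .right)).mp hz
    -- Only the apex of the span maps to both legs.
    rcases f with _ | _ <;> rcases g with _ | _
    exact ⟨x, hf, hg⟩
  obtain ⟨h, rfl, rfl⟩ : ∃ h : pushout a₁ a₂ ⟶ Y, k₁ ≫ h = h₁ ∧ k₂ ≫ h = h₂ :=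
    ⟨pushout.desc h₁ h₂ ha, pushout.inl_desc _ _ _, pushout.inr_desc _ _ _⟩
  exact ⟨_, k₁, k₂, h, hk₁, hk₂, hk, pushout.condition, H, rfl, rfl,
    isSeparated_of_pair k₁ k₂ hk a₁ a₂ pushout.condition H h hcl⟩

end EssFiniteType

/-! ### The schematic image of the overlap in the product. -/

namespace EssFiniteType

open Limits

variable {P W X X₁ X₂ Y Z Z₁ Z₂ : Scheme.{u}}

lemma isSchemeTheoreticallyDominant_toImage (f : X ⟶ Y) [QuasiCompact f] :
    IsSchemeTheoreticallyDominant f.toImage := by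
  rw [isSchemeTheoreticallyDominant_iff]
  refine Scheme.IdealSheafData.ext_of_iSup_eq_top
    (fun U : Y.affineOpens ↦ ⟨f.imageι ⁻¹ᵁ U, U.2.preimage f.imageι⟩) ?_ fun U ↦ ?_
  · refine top_le_iff.mp fun x _ ↦ ?_
    obtain ⟨_, ⟨U, hU, rfl⟩, hxU, -⟩ :=
      Y.isBasis_affineOpens.exists_subset_of_mem_open (Set.mem_univ (f.imageι x)) isOpen_univ
    exact TopologicalSpace.Opens.mem_iSup.mpr ⟨⟨U, hU⟩, hxU⟩
  · rw [Scheme.Hom.ker_apply, (RingHom.injective_iff_ker_eq_bot _).mp (f.toImage_app_injective U)]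
    rfl

/-- A germ killed by `q` vanishes near `x`. As `q` is inducing, it vanishes on the preimage of an
open set of `W`, on which pullback of sections is injective. -/
lemma stalkMap_injective_of_isSchemeTheoreticallyDominant (q : P ⟶ W)
    [IsSchemeTheoreticallyDominant q] [QuasiCompact q] (hq : Topology.IsInducing q) (x : P) :
    Function.Injective (q.stalkMap x) := by
  rw [injective_iff_map_eq_zero]
  intro s hs
  obtain ⟨U, hxU, s, rfl⟩ := W.presheaf.exists_germ_eq s
  rw [Scheme.Hom.germ_stalkMap_apply, ← map_zero (P.presheaf.germ (q ⁻¹ᵁ U) x hxU).hom] at hs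
  obtain ⟨V, hxV, i₁, i₂, hV⟩ := P.presheaf.germ_eq _ hxU hxU _ _ hs
  obtain ⟨V', hV', hVV'⟩ := hq.isOpen_iff.mp V.2
  let N : W.Opens := U ⊓ ⟨V', hV'⟩
  have hxN : q x ∈ N := ⟨hxU, (Set.ext_iff.mp hVV' x).mpr hxV⟩
  have hNV : q ⁻¹ᵁ N ≤ V := fun y hy ↦ (Set.ext_iff.mp hVV' y).mp hy.2
  have hN : W.presheaf.map (homOfLE (inf_le_left : N ≤ U)).op s = 0 := by
    apply q.app_injective N
    rw [map_zero, ← ConcreteCategory.comp_apply, q.naturality, ConcreteCategory.comp_apply]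
    have h := congr(P.presheaf.map (homOfLE hNV).op $hV)
    rw [map_zero, map_zero, ← ConcreteCategory.comp_apply, ← P.presheaf.map_comp] at h
    exact h
  rw [← TopCat.Presheaf.germ_res_apply W.presheaf (homOfLE inf_le_left) _ hxN, hN, map_zero]

/-- The composite forces the stalk map of `q` to be surjective; being also injective, it can be
cancelled. -/
lemma isIso_stalkMap_of_comp (q : P ⟶ W) (p : W ⟶ Z) [IsSchemeTheoreticallyDominant q]
    [QuasiCompact q] [IsPreimmersion (q ≫ p)] (x : P) [IsIso ((q ≫ p).stalkMap x)] :
    IsIso (p.stalkMap (q x)) := by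
  have hq : Topology.IsInducing q :=
    .of_comp q.continuous p.continuous (q ≫ p).isEmbedding.isInducing
  have h : IsIso (p.stalkMap (q x) ≫ q.stalkMap x) := by
    have h := ‹IsIso ((q ≫ p).stalkMap x)›
    rw [Scheme.Hom.stalkMap_comp] at h
    exact h
  have : IsIso (q.stalkMap x) := by
    rw [ConcreteCategory.isIso_iff_bijective] at h ⊢
    exact ⟨stalkMap_injective_of_isSchemeTheoreticallyDominant q hq x,
      fun y ↦ (h.surjective y).elim fun a ha ↦ ⟨p.stalkMap (q x) a, ha⟩⟩
  exact IsIso.of_isIso_comp_right _ (q.stalkMap x)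

/-- A point of the schematic image of `X₁ ∩ X₂` in `Z₁ ×[Y] Z₂` that comes from `X₁` and from `X₂`
comes from `X₁ ∩ X₂`. -/
lemma mem_range_of_mem_range (j₁ : X₁ ⟶ X) (j₂ : X₂ ⟶ X) (i₁ : X₁ ⟶ Z₁) (i₂ : X₂ ⟶ Z₂)
    (f : X ⟶ Y) (h₁ : Z₁ ⟶ Y) (h₂ : Z₂ ⟶ Y) (q : pullback j₁ j₂ ⟶ W) (p₁ : W ⟶ Z₁) (p₂ : W ⟶ Z₂)
    [IsSeparated f] [Flat i₁] [Flat i₂] [Mono i₁] [Mono i₂]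
    [IsSchemeTheoreticallyDominant q] [QuasiCompact q]
    (hi₁ : i₁ ≫ h₁ = j₁ ≫ f) (hi₂ : i₂ ≫ h₂ = j₂ ≫ f) (hp : p₁ ≫ h₁ = p₂ ≫ h₂)
    [Mono (pullback.lift p₁ p₂ hp)]
    (hq₁ : q ≫ p₁ = pullback.fst j₁ j₂ ≫ i₁) (hq₂ : q ≫ p₂ = pullback.snd j₁ j₂ ≫ i₂) (w : W)
    (hw₁ : p₁ w ∈ Set.range i₁) (hw₂ : p₂ w ∈ Set.range i₂) : w ∈ Set.range q := by
  -- `S` is the fibre product over `W` of the pullbacks of `X₁` and `X₂`; it is flat over `W`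
  -- because `i₁` and `i₂` are flat.
  obtain ⟨S, σ, c₁, c₂, _, hσ₁, hσ₂, s, rfl⟩ : ∃ (S : Scheme.{u}) (σ : S ⟶ W) (c₁ : S ⟶ X₁)
      (c₂ : S ⟶ X₂), Flat σ ∧ σ ≫ p₁ = c₁ ≫ i₁ ∧ σ ≫ p₂ = c₂ ≫ i₂ ∧ ∃ s, σ s = w := by
    obtain ⟨x₁, hx₁⟩ := hw₁
    obtain ⟨x₂, hx₂⟩ := hw₂
    obtain ⟨t₁, ht₁, -⟩ := Scheme.Pullback.exists_preimage_pullback w x₁ hx₁.symm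
    obtain ⟨t₂, ht₂, -⟩ := Scheme.Pullback.exists_preimage_pullback w x₂ hx₂.symm
    obtain ⟨s, hs, -⟩ := Scheme.Pullback.exists_preimage_pullback
      (f := pullback.fst p₁ i₁) (g := pullback.fst p₂ i₂) t₁ t₂ (ht₁.trans ht₂.symm)
    refine ⟨_, pullback.fst (pullback.fst p₁ i₁) (pullback.fst p₂ i₂) ≫ pullback.fst p₁ i₁,
      pullback.fst _ _ ≫ pullback.snd p₁ i₁, pullback.snd _ _ ≫ pullback.snd p₂ i₂, inferInstance,
      ?_, ?_, s, ?_⟩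
    · rw [Category.assoc, Category.assoc, pullback.condition]
    · rw [pullback.condition, Category.assoc, Category.assoc, pullback.condition]
    · rw [← ht₁, ← hs]
      rfl
  have hc : (c₁ ≫ j₁) ≫ f = (c₂ ≫ j₂) ≫ f := by
    rw [Category.assoc, Category.assoc, ← hi₁, ← hi₂, ← reassoc_of% hσ₁, ← reassoc_of% hσ₂, hp]
  obtain ⟨m, hm₁, hm₂⟩ : ∃ m : S ⟶ pullback f f,
      m ≫ pullback.fst f f = c₁ ≫ j₁ ∧ m ≫ pullback.snd f f = c₂ ≫ j₂ :=
    ⟨pullback.lift _ _ hc, pullback.lift_fst _ _ _, pullback.lift_snd _ _ _⟩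
  -- the locus where the two maps to `X` agree is closed, and contains `P ×[W] S`
  let ε : pullback (pullback.diagonal f) m ⟶ S := pullback.snd (pullback.diagonal f) m
  have hE : Function.Surjective ε := by
    -- Dominance survives here because `q` is quasi-compact and schematically dominant and `σ` is
    -- flat.
    have hd : IsDominant (pullback.snd q σ) := inferInstance
    have hr₁ : pullback.snd q σ ≫ c₁ = pullback.fst q σ ≫ pullback.fst j₁ j₂ := by
      rw [← cancel_mono i₁, Category.assoc, ← hσ₁, ← pullback.condition_assoc, hq₁, Category.assoc]
    have hr₂ : pullback.snd q σ ≫ c₂ = pullback.fst q σ ≫ pullback.snd j₁ j₂ := by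
      rw [← cancel_mono i₂, Category.assoc, ← hσ₂, ← pullback.condition_assoc, hq₂, Category.assoc]
    have hr : (pullback.snd q σ ≫ c₁ ≫ j₁) ≫ pullback.diagonal f = pullback.snd q σ ≫ m := by
      apply pullback.hom_ext
      · rw [Category.assoc, Category.assoc, pullback.diagonal_fst, Category.comp_id, Category.assoc,
          hm₁]
      · rw [Category.assoc, Category.assoc, pullback.diagonal_snd, Category.comp_id, Category.assoc,
          hm₂, reassoc_of% hr₁, reassoc_of% hr₂, pullback.condition]
    have hle : Set.range (pullback.snd q σ) ⊆ Set.range ε := by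
      rintro _ ⟨r, rfl⟩
      exact ⟨pullback.lift _ _ hr r, by rw [← Scheme.Hom.comp_apply, pullback.lift_snd]⟩
    rw [← Set.range_eq_univ, ← Set.univ_subset_iff, ← hd.1.closure_range]
    exact ε.isClosedEmbedding.isClosed_range.closure_subset_iff.mpr hle
  obtain ⟨e, rfl⟩ := hE s
  have hε : ε ≫ c₁ ≫ j₁ = ε ≫ c₂ ≫ j₂ := by
    have h : pullback.fst (pullback.diagonal f) m ≫ pullback.diagonal f = ε ≫ m :=
      pullback.condition
    have h₁ := congr($h ≫ pullback.fst f f)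
    have h₂ := congr($h ≫ pullback.snd f f)
    rw [Category.assoc, Category.assoc, pullback.diagonal_fst, hm₁] at h₁
    rw [Category.assoc, Category.assoc, pullback.diagonal_snd, hm₂] at h₂
    exact h₁.symm.trans h₂
  -- Where the two maps to `X` agree they define a map to `X₁ ∩ X₂`, so the agreement locus, which
  -- is onto `S`, maps to `W` through `q`.
  obtain ⟨v, hv₁, hv₂⟩ : ∃ v : pullback (pullback.diagonal f) m ⟶ pullback j₁ j₂,
      v ≫ pullback.fst j₁ j₂ = ε ≫ c₁ ∧ v ≫ pullback.snd j₁ j₂ = ε ≫ c₂ :=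
    ⟨pullback.lift _ _ (by simpa using hε), pullback.lift_fst _ _ _, pullback.lift_snd _ _ _⟩
  have hv : v ≫ q = ε ≫ σ := by
    rw [← cancel_mono (pullback.lift p₁ p₂ hp)]
    apply pullback.hom_ext
    · rw [Category.assoc, Category.assoc, Category.assoc, Category.assoc, pullback.lift_fst, hq₁,
        hσ₁, reassoc_of% hv₁]
    · rw [Category.assoc, Category.assoc, Category.assoc, Category.assoc, pullback.lift_snd, hq₂,
        hσ₂, reassoc_of% hv₂]
  exact ⟨v e, congr($hv e)⟩

/-- Let `W` be a closed subscheme of `Z₁ ×[Y] Z₂` and `G` an open subscheme of `W` that is open in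
both factors and contains the points lying over `A₁` and `A₂`. Then suitable open neighbourhoods of
`A₁` and `A₂` can be glued along an open subscheme of `G` to a scheme separated over `Y`. -/
lemma exists_isSeparated_glue (h₁ : Z₁ ⟶ Y) (h₂ : Z₂ ⟶ Y) [IsSeparated h₁] [IsSeparated h₂]
    (p₁ : W ⟶ Z₁) (p₂ : W ⟶ Z₂) (hp : p₁ ≫ h₁ = p₂ ≫ h₂) [AlgebraicGeometry.IsNoetherian W]
    [IsClosedImmersion (pullback.lift p₁ p₂ hp)] (G : W.Opens) [IsOpenImmersion (G.ι ≫ p₁)]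
    [IsOpenImmersion (G.ι ≫ p₂)] {A₁ : Set Z₁} {A₂ : Set Z₂}
    (hA₁ : StableUnderGeneralization A₁) (hA₂ : StableUnderGeneralization A₂)
    (hG : ∀ w, p₁ w ∈ A₁ → p₂ w ∈ A₂ → w ∈ G) :
    ∃ (U₁ : Z₁.Opens) (U₂ : Z₂.Opens) (Z : Scheme.{u}) (k₁ : U₁.toScheme ⟶ Z)
      (k₂ : U₂.toScheme ⟶ Z) (h : Z ⟶ Y), A₁ ⊆ U₁ ∧ A₂ ⊆ U₂ ∧ IsOpenImmersion k₁ ∧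
      IsOpenImmersion k₂ ∧ (∀ z, z ∈ Set.range k₁ ∨ z ∈ Set.range k₂) ∧
      (∀ {T : Scheme.{u}} (t : T ⟶ W) (t₁ : T ⟶ U₁) (t₂ : T ⟶ U₂), t ≫ p₁ = t₁ ≫ U₁.ι →
        t ≫ p₂ = t₂ ≫ U₂.ι → t₁ ≫ k₁ = t₂ ≫ k₂) ∧
      (∀ z₁ z₂, k₁ z₁ = k₂ z₂ → ∃ w, p₁ w = z₁.1 ∧ p₂ w = z₂.1) ∧
      k₁ ≫ h = U₁.ι ≫ h₁ ∧ k₂ ≫ h = U₂.ι ≫ h₂ ∧ IsSeparated h := by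
  obtain ⟨(U₁ : Z₁.Opens), (U₂ : Z₂.Opens), hAU₁, hAU₂, hU⟩ :=
    exists_open_disjoint_of_stableUnderGeneralization p₁.continuous p₂.continuous hA₁ hA₂
    G.2.isClosed_compl
    (fun w hw hw₁ hw₂ ↦ hw (hG w hw₁ hw₂))
  -- The gluing locus: it is open in both factors as it lies in `G`, and closed in `U₁ ×[Y] U₂` as
  -- the full preimage of the closed subscheme `W`.
  let V : W.Opens := p₁ ⁻¹ᵁ U₁ ⊓ p₂ ⁻¹ᵁ U₂
  have hVG : V ≤ G := fun w hw ↦ by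
    by_contra hn
    exact hU w hn hw.1 hw.2
  have hV₁ : IsOpenImmersion (V.ι ≫ p₁) := by
    rw [← W.homOfLE_ι hVG, Category.assoc]
    infer_instance
  have hV₂ : IsOpenImmersion (V.ι ≫ p₂) := by
    rw [← W.homOfLE_ι hVG, Category.assoc]
    infer_instance
  let a₁ : V.toScheme ⟶ U₁ := IsOpenImmersion.lift U₁.ι (V.ι ≫ p₁) (by
    rintro _ ⟨w, rfl⟩
    rw [Scheme.Opens.range_ι]
    exact w.2.1)
  let a₂ : V.toScheme ⟶ U₂ := IsOpenImmersion.lift U₂.ι (V.ι ≫ p₂) (by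
    rintro _ ⟨w, rfl⟩
    rw [Scheme.Opens.range_ι]
    exact w.2.2)
  have ha₁ : a₁ ≫ U₁.ι = V.ι ≫ p₁ := IsOpenImmersion.lift_fac _ _ _
  have ha₂ : a₂ ≫ U₂.ι = V.ι ≫ p₂ := IsOpenImmersion.lift_fac _ _ _
  have : IsOpenImmersion (a₁ ≫ U₁.ι) := by rwa [ha₁]
  have : IsOpenImmersion (a₂ ≫ U₂.ι) := by rwa [ha₂]
  have : IsOpenImmersion a₁ := .of_comp _ U₁.ι
  have : IsOpenImmersion a₂ := .of_comp _ U₂.ι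
  have ha : a₁ ≫ U₁.ι ≫ h₁ = a₂ ≫ U₂.ι ≫ h₂ := by
    rw [reassoc_of% ha₁, reassoc_of% ha₂, hp]
  let μ : pullback (U₁.ι ≫ h₁) (U₂.ι ≫ h₂) ⟶ pullback h₁ h₂ :=
    pullback.map _ _ _ _ U₁.ι U₂.ι (𝟙 Y) (by simp) (by simp)
  have hμ : pullback.lift a₁ a₂ ha ≫ μ = V.ι ≫ pullback.lift p₁ p₂ hp := by
    apply pullback.hom_ext
    · rw [Category.assoc, Category.assoc, pullback.lift_fst, pullback.lift_fst,
        pullback.lift_fst_assoc, ha₁]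
    · rw [Category.assoc, Category.assoc, pullback.lift_snd, pullback.lift_snd,
        pullback.lift_snd_assoc, ha₂]
  have hcl : IsClosed (Set.range (pullback.lift a₁ a₂ ha)) := by
    have : Set.range (pullback.lift a₁ a₂ ha) = μ ⁻¹' Set.range (pullback.lift p₁ p₂ hp) := by
      refine subset_antisymm ?_ ?_
      · rintro _ ⟨v, rfl⟩
        exact ⟨V.ι v, congr($hμ v).symm⟩
      · rintro t ⟨w, hw⟩
        have hw₁ : p₁ w = (pullback.fst (U₁.ι ≫ h₁) (U₂.ι ≫ h₂) t).1 := by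
          have h := congr(pullback.fst h₁ h₂ $hw)
          rw [← Scheme.Hom.comp_apply, ← Scheme.Hom.comp_apply, pullback.lift_fst,
            pullback.lift_fst] at h
          exact h
        have hw₂ : p₂ w = (pullback.snd (U₁.ι ≫ h₁) (U₂.ι ≫ h₂) t).1 := by
          have h := congr(pullback.snd h₁ h₂ $hw)
          rw [← Scheme.Hom.comp_apply, ← Scheme.Hom.comp_apply, pullback.lift_snd,
            pullback.lift_snd] at h
          exact h
        have hwV : w ∈ V := by
          refine ⟨?_, ?_⟩
          · change p₁ w ∈ U₁
            exact hw₁ ▸ (pullback.fst (U₁.ι ≫ h₁) (U₂.ι ≫ h₂) t).2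
          · change p₂ w ∈ U₂
            exact hw₂ ▸ (pullback.snd (U₁.ι ≫ h₁) (U₂.ι ≫ h₂) t).2
        let v : V.toScheme := ⟨w, hwV⟩
        exact ⟨v, μ.injective (congr($hμ v).trans hw)⟩
    rw [this]
    exact (pullback.lift p₁ p₂ hp).isClosedEmbedding.isClosed_range.preimage μ.continuous
  obtain ⟨Z, k₁, k₂, h, hk₁, hk₂, hk, hak, H, hh₁, hh₂, hh⟩ :=
    exists_isSeparated_pushout a₁ a₂ (U₁.ι ≫ h₁) (U₂.ι ≫ h₂) ha hcl
  refine ⟨U₁, U₂, Z, k₁, k₂, h, hAU₁, hAU₂, hk₁, hk₂, hk, ?_, ?_, hh₁, hh₂, hh⟩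
  · intro T t t₁ t₂ ht₁ ht₂
    let t' : T ⟶ V := IsOpenImmersion.lift V.ι t (by
      rintro _ ⟨x, rfl⟩
      rw [Scheme.Opens.range_ι]
      have e₁ : p₁ (t x) = (t₁ x).1 := congr($ht₁ x)
      have e₂ : p₂ (t x) = (t₂ x).1 := congr($ht₂ x)
      exact ⟨(e₁ ▸ (t₁ x).2 : p₁ (t x) ∈ U₁), (e₂ ▸ (t₂ x).2 : p₂ (t x) ∈ U₂)⟩)
    have ht' : t' ≫ V.ι = t := IsOpenImmersion.lift_fac _ _ _
    have e₁ : t₁ = t' ≫ a₁ := by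
      rw [← cancel_mono U₁.ι, Category.assoc, ha₁, reassoc_of% ht', ht₁]
    have e₂ : t₂ = t' ≫ a₂ := by
      rw [← cancel_mono U₂.ι, Category.assoc, ha₂, reassoc_of% ht', ht₂]
    rw [e₁, e₂, Category.assoc, Category.assoc, hak]
  · intro z₁ z₂ hz
    obtain ⟨v, rfl, rfl⟩ := H z₁ z₂ hz
    exact ⟨V.ι v, congr($ha₁.symm v), congr($ha₂.symm v)⟩

end EssFiniteType

/-! ### Construction of the factorization. -/

namespace EssFiniteType

open Limits

variable {P W X X₁ X₂ Y Z Z₁ Z₂ : Scheme.{u}}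

lemma HasCharts.of_comp_isOpenImmersion {Q : MorphismProperty CommRingCat.{u}}
    (hQ : LocalizationClass Q) (l : X ⟶ Y) (ι : Y ⟶ Z) [IsOpenImmersion ι]
    (h : HasCharts Q (l ≫ ι)) : HasCharts Q l := fun x ↦ by
  obtain ⟨_, ⟨V, hV, rfl⟩, hxV, -⟩ :=
    Y.isBasis_affineOpens.exists_subset_of_mem_open (Set.mem_univ (l x)) isOpen_univ
  obtain ⟨U, e, hU, hxU, -, hq⟩ := h.exists_le hQ x (hV.image_of_isOpenImmersion ι)
    (N := ⊤) ⟨l x, hxV, rfl⟩ trivial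
  have e' : U ≤ l ⁻¹ᵁ V := fun y hy ↦ by
    obtain ⟨v, hv, hvy⟩ := e hy
    have hvy' : v = l y := ι.injective hvy
    exact (hvy' ▸ hv : l y ∈ V)
  refine ⟨V, U, e', hV, hU, hxU, ?_⟩
  have : l.appLE V U e' = (ι.appIso V).inv ≫ (l ≫ ι).appLE (ι ''ᵁ V) U e := by
    rw [Iso.eq_inv_comp, ι.appIso_hom', Scheme.Hom.appLE_comp_appLE]
  rw [this]
  exact hQ.comp _ _ (hQ.of_localizing _ (IsLocalizingHom.of_isIso _)) hq

/-- `f` factors as an injective morphism with localizing charts, followed by a separated morphism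
of finite type. -/
def HasFactorization (f : X ⟶ Y) : Prop :=
  ∃ (Z : Scheme.{u}) (i : X ⟶ Z) (h : Z ⟶ Y), i ≫ h = f ∧ HasLocalizingCharts i ∧
    Function.Injective i ∧ LocallyOfFiniteType h ∧ QuasiCompact h ∧ IsSeparated h

lemma isNoetherian_of_pair (k₁ : Z₁ ⟶ Z) (k₂ : Z₂ ⟶ Z)
    (hk : ∀ z, z ∈ Set.range k₁ ∨ z ∈ Set.range k₂) [AlgebraicGeometry.IsNoetherian Z₁]
    [AlgebraicGeometry.IsNoetherian Z₂] [IsLocallyNoetherian Z] :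
    AlgebraicGeometry.IsNoetherian Z where
  toCompactSpace := by
    have : (Set.univ : Set Z) = Set.range k₁ ∪ Set.range k₂ :=
      (Set.eq_univ_of_forall hk).symm
    exact ⟨this ▸ (isCompact_range k₁.continuous).union (isCompact_range k₂.continuous)⟩

lemma locallyOfFiniteType_of_pair (k₁ : Z₁ ⟶ Z) (k₂ : Z₂ ⟶ Z) [IsOpenImmersion k₁]
    [IsOpenImmersion k₂] (hk : ∀ z, z ∈ Set.range k₁ ∨ z ∈ Set.range k₂) (h : Z ⟶ Y)
    [h₁ : LocallyOfFiniteType (k₁ ≫ h)] [h₂ : LocallyOfFiniteType (k₂ ≫ h)] :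
    LocallyOfFiniteType h := by
  have : IsZariskiLocalAtSource @LocallyOfFiniteType.{u} :=
    HasRingHomProperty.instIsZariskiLocalAtSource
  rw [IsZariskiLocalAtSource.iff_of_openCover (P := @LocallyOfFiniteType) (coverOfPair k₁ k₂ hk)]
  rintro ⟨_ | _⟩
  exacts [h₁, h₂]

/-- The schematic image of `X₁ ∩ X₂` in `Z₁ ×[Y] Z₂` is open in both factors around the image of
`X₁ ∩ X₂`. -/
lemma exists_isOpenImmersion_of_isPreimmersion (q : P ⟶ W) (p : W ⟶ Z)
    [IsSchemeTheoreticallyDominant q] [QuasiCompact q] [LocallyOfFiniteType p]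
    [AlgebraicGeometry.IsNoetherian P] [AlgebraicGeometry.IsNoetherian W]
    [IsLocallyNoetherian Z] [Flat (q ≫ p)] [SurjectiveOnStalks (q ≫ p)]
    (hinj : Function.Injective (q ≫ p)) :
    ∃ G : W.Opens, Set.range q ⊆ G ∧ IsOpenImmersion (G.ι ≫ p) := by
  have : IsPreimmersion (q ≫ p) := isPreimmersion_of_flat _ hinj
  refine exists_isOpenImmersion_of_generalizingMap q p (Flat.generalizingMap _) hinj fun x ↦ ?_
  have := isIso_stalkMap_of_flat_of_surjectiveOnStalks (q ≫ p) x
  exact isIso_stalkMap_of_comp q p x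

lemma HasFactorization.of_pair [AlgebraicGeometry.IsNoetherian X]
    [AlgebraicGeometry.IsNoetherian Y] (j₁ : X₁ ⟶ X) (j₂ : X₂ ⟶ X) [IsOpenImmersion j₁]
    [IsOpenImmersion j₂] (hj : ∀ x, x ∈ Set.range j₁ ∨ x ∈ Set.range j₂) (f : X ⟶ Y)
    [IsSeparated f] (hf₁ : HasFactorization (j₁ ≫ f)) (hf₂ : HasFactorization (j₂ ≫ f)) :
    HasFactorization f := by
  obtain ⟨Z₁, i₁, h₁, hih₁, hi₁, hinj₁, _, _, _⟩ := hf₁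
  obtain ⟨Z₂, i₂, h₂, hih₂, hi₂, hinj₂, _, _, _⟩ := hf₂
  have hnZ₁ : AlgebraicGeometry.IsNoetherian Z₁ := isNoetherian_of_finiteType h₁
  have hnZ₂ : AlgebraicGeometry.IsNoetherian Z₂ := isNoetherian_of_finiteType h₂
  have hnP : AlgebraicGeometry.IsNoetherian (pullback j₁ j₂) :=
    isNoetherian_of_isOpenImmersion (pullback.fst j₁ j₂ ≫ j₁)
  have hnT : AlgebraicGeometry.IsNoetherian (pullback h₁ h₂) :=
    isNoetherian_of_finiteType (pullback.fst h₁ h₂)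
  have := hi₁.flat
  have := hi₂.flat
  have := hi₁.surjectiveOnStalks
  have := hi₂.surjectiveOnStalks
  have : Mono i₁ := SurjectiveOnStalks.mono_of_injective hinj₁
  have : Mono i₂ := SurjectiveOnStalks.mono_of_injective hinj₂
  let t : pullback j₁ j₂ ⟶ pullback h₁ h₂ :=
    pullback.lift (pullback.fst j₁ j₂ ≫ i₁) (pullback.snd j₁ j₂ ≫ i₂) (by
      rw [Category.assoc, Category.assoc, hih₁, hih₂, pullback.condition_assoc])
  obtain ⟨W, ι, q, _, _, hqt⟩ : ∃ (W : Scheme.{u}) (ι : W ⟶ pullback h₁ h₂)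
      (q : pullback j₁ j₂ ⟶ W), IsClosedImmersion ι ∧ IsSchemeTheoreticallyDominant q ∧
      q ≫ ι = t :=
    ⟨t.image, t.imageι, t.toImage, inferInstance, isSchemeTheoreticallyDominant_toImage t,
      t.toImage_imageι⟩
  have hnW : AlgebraicGeometry.IsNoetherian W := isNoetherian_of_finiteType ι
  let p₁ : W ⟶ Z₁ := ι ≫ pullback.fst h₁ h₂
  let p₂ : W ⟶ Z₂ := ι ≫ pullback.snd h₁ h₂
  have hp : p₁ ≫ h₁ = p₂ ≫ h₂ := by
    simp only [p₁, p₂, Category.assoc, pullback.condition]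
  have hι : pullback.lift p₁ p₂ hp = ι := by
    apply pullback.hom_ext
    · rw [pullback.lift_fst]
    · rw [pullback.lift_snd]
  have : IsClosedImmersion (pullback.lift p₁ p₂ hp) := by rwa [hι]
  have hq₁ : q ≫ p₁ = pullback.fst j₁ j₂ ≫ i₁ := by
    rw [reassoc_of% hqt, pullback.lift_fst]
  have hq₂ : q ≫ p₂ = pullback.snd j₁ j₂ ≫ i₂ := by
    rw [reassoc_of% hqt, pullback.lift_snd]
  have hb := mem_range_of_mem_range j₁ j₂ i₁ i₂ f h₁ h₂ q p₁ p₂ hih₁ hih₂ hp hq₁ hq₂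
  obtain ⟨G₁, hqG₁, hG₁⟩ : ∃ G : W.Opens, Set.range q ⊆ G ∧ IsOpenImmersion (G.ι ≫ p₁) := by
    have : Flat (q ≫ p₁) := by rw [hq₁]; infer_instance
    have : SurjectiveOnStalks (q ≫ p₁) := by rw [hq₁]; infer_instance
    refine exists_isOpenImmersion_of_isPreimmersion q p₁ ?_
    rw [hq₁]
    exact hinj₁.comp (pullback.fst j₁ j₂).injective
  obtain ⟨G₂, hqG₂, hG₂⟩ : ∃ G : W.Opens, Set.range q ⊆ G ∧ IsOpenImmersion (G.ι ≫ p₂) := by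
    have : Flat (q ≫ p₂) := by rw [hq₂]; infer_instance
    have : SurjectiveOnStalks (q ≫ p₂) := by rw [hq₂]; infer_instance
    refine exists_isOpenImmersion_of_isPreimmersion q p₂ ?_
    rw [hq₂]
    exact hinj₂.comp (pullback.snd j₁ j₂).injective
  have : IsOpenImmersion ((G₁ ⊓ G₂).ι ≫ p₁) := by
    rw [← W.homOfLE_ι inf_le_left, Category.assoc]
    infer_instance
  have : IsOpenImmersion ((G₁ ⊓ G₂).ι ≫ p₂) := by
    rw [← W.homOfLE_ι inf_le_right, Category.assoc]
    infer_instance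
  obtain ⟨U₁, U₂, Z, k₁, k₂, h, hAU₁, hAU₂, hk₁, hk₂, hk, hdesc, hinj, hh₁, hh₂, _⟩ :=
    exists_isSeparated_glue h₁ h₂ p₁ p₂ hp (G₁ ⊓ G₂)
      (Flat.generalizingMap i₁).stableUnderGeneralization_range
      (Flat.generalizingMap i₂).stableUnderGeneralization_range
      (fun w hw₁ hw₂ ↦ ⟨hqG₁ (hb w hw₁ hw₂), hqG₂ (hb w hw₁ hw₂)⟩)
  obtain ⟨l₁, hl₁⟩ : ∃ l₁ : X₁ ⟶ U₁, l₁ ≫ U₁.ι = i₁ :=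
    ⟨IsOpenImmersion.lift U₁.ι i₁ (by rwa [Scheme.Opens.range_ι]), IsOpenImmersion.lift_fac _ _ _⟩
  obtain ⟨l₂, hl₂⟩ : ∃ l₂ : X₂ ⟶ U₂, l₂ ≫ U₂.ι = i₂ :=
    ⟨IsOpenImmersion.lift U₂.ι i₂ (by rwa [Scheme.Opens.range_ι]), IsOpenImmersion.lift_fac _ _ _⟩
  obtain ⟨i, hji₁, hji₂⟩ := exists_desc_of_pair j₁ j₂ hj (l₁ ≫ k₁) (l₂ ≫ k₂) (by
    have := hdesc q (pullback.fst j₁ j₂ ≫ l₁) (pullback.snd j₁ j₂ ≫ l₂)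
      (by rw [hq₁, Category.assoc, hl₁]) (by rw [hq₂, Category.assoc, hl₂])
    simpa using this)
  have hlinj₁ : Function.Injective l₁ := fun a b hab ↦
    hinj₁ (by rw [← hl₁, Scheme.Hom.comp_apply, Scheme.Hom.comp_apply, hab])
  have hlinj₂ : Function.Injective l₂ := fun a b hab ↦
    hinj₂ (by rw [← hl₂, Scheme.Hom.comp_apply, Scheme.Hom.comp_apply, hab])
  -- A coincidence in `Z` between the two pieces comes from a point of `W` over both `X₁` and `X₂`,
  -- hence from `X₁ ∩ X₂`.
  have hmix (x₁ : X₁) (x₂ : X₂) (hx : i (j₁ x₁) = i (j₂ x₂)) : j₁ x₁ = j₂ x₂ := by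
    obtain ⟨w, hw₁, hw₂⟩ := hinj (l₁ x₁) (l₂ x₂)
      ((congr($hji₁ x₁).symm.trans hx).trans congr($hji₂ x₂))
    replace hw₁ : p₁ w = i₁ x₁ := hw₁.trans congr($hl₁ x₁)
    replace hw₂ : p₂ w = i₂ x₂ := hw₂.trans congr($hl₂ x₂)
    obtain ⟨u, rfl⟩ := hb w ⟨x₁, hw₁.symm⟩ ⟨x₂, hw₂.symm⟩
    rw [← hinj₁ (congr($hq₁ u).symm.trans hw₁), ← hinj₂ (congr($hq₂ u).symm.trans hw₂)]
    exact congr($(pullback.condition (f := j₁) (g := j₂)) u)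
  have : LocallyOfFiniteType (k₁ ≫ h) := by rw [hh₁]; infer_instance
  have : LocallyOfFiniteType (k₂ ≫ h) := by rw [hh₂]; infer_instance
  have : LocallyOfFiniteType h := locallyOfFiniteType_of_pair k₁ k₂ hk h
  have : IsLocallyNoetherian Z := LocallyOfFiniteType.isLocallyNoetherian h
  have := isNoetherian_of_isOpenImmersion U₁.ι
  have := isNoetherian_of_isOpenImmersion U₂.ι
  have : AlgebraicGeometry.IsNoetherian Z := isNoetherian_of_pair k₁ k₂ hk
  refine ⟨Z, i, h, ?_, ?_, ?_, inferInstance, inferInstance, inferInstance⟩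
  · refine hom_ext_of_pair j₁ j₂ hj ?_ ?_
    · rw [reassoc_of% hji₁, hh₁, reassoc_of% hl₁, hih₁]
    · rw [reassoc_of% hji₂, hh₂, reassoc_of% hl₂, hih₂]
  · have hQ := localizationClass_localizing.{u}
    have hl₁ : HasLocalizingCharts l₁ := .of_comp_isOpenImmersion hQ l₁ U₁.ι (by rwa [hl₁])
    have hl₂ : HasLocalizingCharts l₂ := .of_comp_isOpenImmersion hQ l₂ U₂.ι (by rwa [hl₂])
    refine .of_forall_exists_isOpenImmersion hQ i fun x ↦ ?_
    obtain ⟨a, rfl⟩ | ⟨a, rfl⟩ := hj x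
    · exact ⟨X₁, j₁, a, ‹_›, rfl, hji₁ ▸ hl₁.comp hQ (.of_isOpenImmersion hQ k₁)⟩
    · exact ⟨X₂, j₂, a, ‹_›, rfl, hji₂ ▸ hl₂.comp hQ (.of_isOpenImmersion hQ k₂)⟩
  · intro x y hxy
    obtain ⟨a, rfl⟩ | ⟨a, rfl⟩ := hj x <;> obtain ⟨b, rfl⟩ | ⟨b, rfl⟩ := hj y
    · refine congr_arg _ (hlinj₁ (k₁.injective ?_))
      exact (congr($hji₁ a).symm.trans hxy).trans congr($hji₁ b)
    · exact hmix a b hxy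
    · exact (hmix b a hxy.symm).symm
    · refine congr_arg _ (hlinj₂ (k₂.injective ?_))
      exact (congr($hji₂ a).symm.trans hxy).trans congr($hji₂ b)

lemma HasFactorization.of_isEmpty [IsEmpty X] (f : X ⟶ Y) : HasFactorization f :=
  ⟨X, 𝟙 X, f, Category.id_comp f, .of_isOpenImmersion localizationClass_localizing _,
    Function.injective_id, inferInstance, inferInstance, inferInstance⟩

lemma HasFactorization.of_isIso_comp (e : Z ⟶ X) [IsIso e] (f : X ⟶ Y)
    (h : HasFactorization (e ≫ f)) : HasFactorization f := by
  obtain ⟨Z', i, h, hih, hi, hinj, hh⟩ := h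
  have hQ := localizationClass_localizing.{u}
  refine ⟨Z', inv e ≫ i, h, by simp [hih],
    HasCharts.comp hQ (.of_isOpenImmersion hQ (inv e)) hi, ?_, hh⟩
  exact hinj.comp (inv e).injective

lemma hasLocalizingCharts_of_isLocalizingHom [IsAffine X] {R : CommRingCat.{u}}
    (f : X ⟶ Spec R) {S : CommRingCat.{u}} (e : X ≅ Spec S) (φ : R ⟶ S)
    (hf : f = e.hom ≫ Spec.map φ) (hφ : IsLocalizingHom φ.hom) :
    HasLocalizingCharts f ∧ Function.Injective f := by
  have hQ := localizationClass_localizing.{u}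
  subst hf
  refine ⟨HasCharts.comp hQ (.of_isOpenImmersion hQ _) (.of_isAffine _ ?_), ?_⟩
  · have : (Spec.map φ).appTop = (Scheme.ΓSpecIso R).hom ≫ φ ≫ (Scheme.ΓSpecIso S).inv := by
      rw [Scheme.ΓSpecIso_inv_naturality, Iso.hom_inv_id_assoc]
    rw [this]
    exact hQ.comp _ _ (hQ.of_localizing _ (IsLocalizingHom.of_isIso _))
      (hQ.comp _ _ hφ (hQ.of_localizing _ (IsLocalizingHom.of_isIso _)))
  · obtain ⟨M, hM⟩ := hφ
    let := φ.hom.toAlgebra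
    exact (PrimeSpectrum.localization_comap_injective S M).comp e.hom.injective

/-- The middle scheme is `Spec` of a finitely generated subalgebra of which `Γ(X, U)` is a
localization. -/
lemma HasFactorization.of_isAffineOpen [AlgebraicGeometry.IsNoetherian Y] (f : X ⟶ Y)
    {V : Y.Opens} {U : X.Opens} (e : U ≤ f ⁻¹ᵁ V) (hV : IsAffineOpen V) (hU : IsAffineOpen U)
    (h : (f.appLE V U e).hom.EssFiniteType) : HasFactorization (U.ι ≫ f) := by
  let φ := f.appLE V U e
  let := φ.hom.toAlgebra
  have : Algebra.EssFiniteType Γ(Y, V) Γ(X, U) := h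
  let C := Algebra.EssFiniteType.subalgebra Γ(Y, V) Γ(X, U)
  let α : Γ(Y, V) ⟶ CommRingCat.of C := CommRingCat.ofHom (algebraMap Γ(Y, V) C)
  let β : CommRingCat.of C ⟶ Γ(X, U) := CommRingCat.ofHom (algebraMap C Γ(X, U))
  have hβ : IsLocalizingHom β.hom :=
    isLocalizingHom_algebraMap (Algebra.EssFiniteType.submonoid Γ(Y, V) Γ(X, U))
  have hαβ : α ≫ β = φ := rfl
  have : IsAffine U := hU
  obtain ⟨hi, hinj⟩ := hasLocalizingCharts_of_isLocalizingHom _ hU.isoSpec β rfl hβ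
  have hnV : AlgebraicGeometry.IsNoetherian (Spec Γ(Y, V)) :=
    isNoetherian_of_isOpenImmersion hV.fromSpec
  have : LocallyOfFiniteType (Spec.map α) := by
    rw [HasRingHomProperty.Spec_iff (P := @LocallyOfFiniteType)]
    exact RingHom.finiteType_algebraMap.mpr inferInstance
  refine ⟨_, _, Spec.map α ≫ hV.fromSpec, ?_, hi, hinj, inferInstance, inferInstance,
    inferInstance⟩
  rw [Category.assoc, ← Spec.map_comp_assoc, hαβ, IsAffineOpen.SpecMap_appLE_fromSpec f hV hU e,
    hU.isoSpec_hom_fromSpec_assoc]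

/-- A separated morphism of noetherian schemes that is essentially of finite type factors as an
injective localizing morphism, followed by a separated morphism of finite type. -/
theorem HasFactorization.of_hasCharts [AlgebraicGeometry.IsNoetherian X]
    [AlgebraicGeometry.IsNoetherian Y] (f : X ⟶ Y) [IsSeparated f]
    (hf : HasCharts essFiniteTypeClass f) : HasFactorization f := by
  obtain ⟨U, hU, h⟩ : ∃ U : X.Opens, (Set.univ : Set X) ⊆ U ∧ HasFactorization (U.ι ≫ f) := by
    -- Opens with a factorization are stable under binary unions by `of_pair`, so compactness of `X`
    -- suffices.
    refine isCompact_univ.induction_on (p := fun s ↦ ∃ U : X.Opens, s ⊆ (U : Set X) ∧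
      HasFactorization (U.ι ≫ f)) ?_ ?_ ?_ ?_
    · have : IsEmpty (⊥ : X.Opens).toScheme := ⟨fun x ↦ x.2⟩
      exact ⟨⊥, Set.empty_subset _, .of_isEmpty _⟩
    · exact fun s t hst ⟨U, hU, h⟩ ↦ ⟨U, hst.trans hU, h⟩
    · rintro s t ⟨U, hU, h⟩ ⟨V, hV, h'⟩
      refine ⟨U ⊔ V, Set.union_subset_union hU hV, ?_⟩
      have := isNoetherian_of_isOpenImmersion (U ⊔ V).ι
      refine .of_pair (X.homOfLE (le_sup_left : U ≤ U ⊔ V)) (X.homOfLE (le_sup_right : V ≤ U ⊔ V))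
        ?_ _ (by rwa [X.homOfLE_ι_assoc]) (by rwa [X.homOfLE_ι_assoc])
      rintro ⟨x, hx | hx⟩
      · exact .inl ⟨⟨x, hx⟩, (U ⊔ V).ι.injective congr($(X.homOfLE_ι le_sup_left) ⟨x, hx⟩)⟩
      · exact .inr ⟨⟨x, hx⟩, (U ⊔ V).ι.injective congr($(X.homOfLE_ι le_sup_right) ⟨x, hx⟩)⟩
    · intro x _
      obtain ⟨V, U, e, hV, hU, hx, hq⟩ := hf x
      exact ⟨U, mem_nhdsWithin_of_mem_nhds (U.2.mem_nhds hx), U, subset_rfl,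
        .of_isAffineOpen f e hV hU hq⟩
  obtain rfl : U = ⊤ := top_le_iff.mp fun x _ ↦ hU trivial
  have : IsIso (⊤ : X.Opens).ι := (Scheme.topIso X).isIso_hom
  exact .of_isIso_comp (⊤ : X.Opens).ι f h

end EssFiniteType

/-! ### From charts to the definitions, and transfer of `P`. -/

namespace EssFiniteType

variable {X Y Z : Scheme.{u}}

lemma IsEssFiniteType.hasCharts {f : X ⟶ Y} (hf : IsEssFiniteType f) :
    HasCharts essFiniteTypeClass f := fun x ↦ by
  obtain ⟨V, hV, s, -, hs, h⟩ := hf (f x)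
  have hx : x ∈ ⨆ U ∈ s, U.1 := hs ▸ hV
  simp only [TopologicalSpace.Opens.mem_iSup] at hx
  obtain ⟨U, hU, hxU⟩ := hx
  obtain ⟨e, he⟩ := h U hU
  exact ⟨V, U, e, V.2, U.2, hxU, he⟩

/-- Charts can be taken over a fixed affine `V`, and finitely many suffice because preimages of
opens are compact in the noetherian `X`. -/
lemma HasCharts.exists_finite {Q : MorphismProperty CommRingCat.{u}} (hQ : LocalizationClass Q)
    [AlgebraicGeometry.IsNoetherian X] {f : X ⟶ Y} (hf : HasCharts Q f) (y : Y) :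
    ∃ V : Y.affineOpens, y ∈ V.1 ∧ ∃ s : Set X.affineOpens, s.Finite ∧
      (⨆ U ∈ s, U.1) = f ⁻¹ᵁ V.1 ∧
      ∀ U ∈ s, ∃ e : U.1 ≤ f ⁻¹ᵁ V.1, Q (f.appLE V.1 U.1 e) := by
  obtain ⟨_, ⟨V, hV, rfl⟩, hyV, -⟩ :=
    Y.isBasis_affineOpens.exists_subset_of_mem_open (Set.mem_univ y) isOpen_univ
  choose U e hU hxU hle hq using fun x : (f ⁻¹ᵁ V : X.Opens) ↦
    hf.exists_le hQ x.1 hV (N := ⊤) x.2 trivial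
  obtain ⟨t, ht⟩ := (TopologicalSpace.NoetherianSpace.isCompact
    ((f ⁻¹ᵁ V : X.Opens) : Set X)).elim_finite_subcover (fun x ↦ (U x : Set X))
    (fun x ↦ (U x).2) (fun x hx ↦ Set.mem_iUnion.mpr ⟨⟨x, hx⟩, hxU _⟩)
  refine ⟨⟨V, hV⟩, hyV, (fun x ↦ ⟨U x, hU x⟩) '' (t : Set _),
    t.finite_toSet.image _, le_antisymm ?_ ?_, ?_⟩
  · refine iSup₂_le ?_
    rintro _ ⟨x, -, rfl⟩
    exact e x
  · intro x hx
    obtain ⟨y, hy, hxy⟩ := Set.mem_iUnion₂.mp (ht hx)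
    simp only [TopologicalSpace.Opens.mem_iSup]
    exact ⟨_, ⟨y, hy, rfl⟩, hxy⟩
  · rintro _ ⟨x, -, rfl⟩
    exact ⟨e x, hq x⟩

lemma HasLocalizingCharts.isLocalizingImmersion [AlgebraicGeometry.IsNoetherian X]
    [AlgebraicGeometry.IsNoetherian Y] {f : X ⟶ Y} (hf : HasLocalizingCharts f)
    (hinj : Function.Injective f) : IsLocalizingImmersion f :=
  ⟨inferInstance, inferInstance, hf.exists_finite localizationClass_localizing, hinj⟩

lemma isLocalizingImmersion_of_isOpenImmersion [AlgebraicGeometry.IsNoetherian Y] (f : X ⟶ Y)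
    [IsOpenImmersion f] : IsLocalizingImmersion f :=
  have := isNoetherian_of_isOpenImmersion f
  HasLocalizingCharts.isLocalizingImmersion
    (.of_isOpenImmersion localizationClass_localizing f) f.injective

lemma Se.of_hasCharts [AlgebraicGeometry.IsNoetherian X] [AlgebraicGeometry.IsNoetherian Y]
    {f : X ⟶ Y} [IsSeparated f] (hf : HasCharts essFiniteTypeClass f) : Se f :=
  ⟨inferInstance, inferInstance, inferInstance,
    hf.exists_finite localizationClass_essFiniteType⟩

lemma hasCharts_essFiniteType_of_locallyOfFiniteType (f : X ⟶ Y) [LocallyOfFiniteType f] :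
    HasCharts essFiniteTypeClass f := fun x ↦ by
  obtain ⟨_, ⟨V, hV, rfl⟩, hxV, -⟩ :=
    Y.isBasis_affineOpens.exists_subset_of_mem_open (Set.mem_univ (f x)) isOpen_univ
  obtain ⟨_, ⟨U, hU, rfl⟩, hxU, e⟩ :=
    X.isBasis_affineOpens.exists_subset_of_mem_open (show x ∈ f ⁻¹ᵁ V from hxV) (f ⁻¹ᵁ V).2
  refine ⟨V, U, e, hV, hU, hxU, ?_⟩
  have h : (f.appLE V U e).hom.FiniteType := f.finiteType_appLE hV hU e
  let := (f.appLE V U e).hom.toAlgebra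
  have : Algebra.FiniteType Γ(Y, V) Γ(X, U) := h
  exact (inferInstance : Algebra.EssFiniteType Γ(Y, V) Γ(X, U))

lemma hasLocalizingCharts_fromSpecStalk (x : X) :
    HasLocalizingCharts (X.fromSpecStalk x) ∧ Function.Injective (X.fromSpecStalk x) := by
  obtain ⟨_, ⟨U, hU, rfl⟩, hxU, -⟩ :=
    X.isBasis_affineOpens.exists_subset_of_mem_open (Set.mem_univ x) isOpen_univ
  replace hU : IsAffineOpen U := hU
  have hg : IsLocalizingHom (X.presheaf.germ U x hxU).hom := by
    let := X.presheaf.algebra_section_stalk ⟨x, hxU⟩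
    have : IsLocalization (hU.primeIdealOf ⟨x, hxU⟩).asIdeal.primeCompl (X.presheaf.stalk x) :=
      hU.isLocalization_stalk ⟨x, hxU⟩
    exact isLocalizingHom_algebraMap (hU.primeIdealOf ⟨x, hxU⟩).asIdeal.primeCompl
  obtain ⟨hc, hi⟩ := hasLocalizingCharts_of_isLocalizingHom
    (Spec.map (X.presheaf.germ U x hxU)) (Iso.refl _) _ (Category.id_comp _).symm hg
  have h : Spec.map (X.presheaf.germ U x hxU) ≫ hU.fromSpec = X.fromSpecStalk x :=
    hU.fromSpecStalk_eq_fromSpecStalk hxU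
  have hQ := localizationClass_localizing.{u}
  rw [← h]
  have : IsOpenImmersion hU.fromSpec := inferInstance
  exact ⟨HasCharts.comp hQ hc (.of_isOpenImmersion hQ _), hU.fromSpec.injective.comp hi⟩

lemma isLocalizingImmersion_fromSpecStalk [AlgebraicGeometry.IsNoetherian X] (x : X) :
    IsLocalizingImmersion (X.fromSpecStalk x) :=
  (hasLocalizingCharts_fromSpecStalk x).1.isLocalizingImmersion
    (hasLocalizingCharts_fromSpecStalk x).2

lemma Se.localMap {f : X ⟶ Y} (hf : Se f) (x : X) : Se (localMap f x) := by
  obtain ⟨_, _, _, he⟩ := hf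
  have h := isLocalizingImmersion_fromSpecStalk x
  have := h.noetherian_source
  have : IsSeparated (EssFiniteType.localMap f x) := inferInstance
  refine .of_hasCharts (HasCharts.comp localizationClass_essFiniteType ?_ he.hasCharts)
  exact (hasLocalizingCharts_fromSpecStalk x).1.mono fun _ _ _ ↦ IsLocalizingHom.essFiniteType

variable {P : MorphismProperty Scheme.{u}}

/-- The property of the germ of a morphism depends only on the local ring. -/
lemma localMap_comp_iff (hloc : IsStableUnderLocalization P) (i : X ⟶ Z) (h : Z ⟶ Y)
    (hi : IsLocalizingImmersion i) (hic : HasLocalizingCharts i) (hf : Se (i ≫ h)) (hh : Se h)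
    (x : X) : P (localMap (i ≫ h) x) ↔ P (localMap h (i x)) := by
  have := hi.noetherian_source
  have := hi.noetherian_target
  have := hic.flat
  have := hic.surjectiveOnStalks
  have := isIso_stalkMap_of_flat_of_surjectiveOnStalks i x
  -- The stalk map is an isomorphism, and isomorphisms are localizing immersions, so (α) applies in
  -- both directions.
  have he : localMap (i ≫ h) x = Spec.map (i.stalkMap x) ≫ localMap h (i x) := by
    simp only [localMap, Scheme.SpecMap_stalkMap_fromSpecStalk_assoc]
  have := (isLocalizingImmersion_fromSpecStalk x).noetherian_source
  have := (isLocalizingImmersion_fromSpecStalk (i x)).noetherian_source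
  refine ⟨fun hP ↦ ?_, fun hP ↦ ?_⟩
  · have h' := hloc (inv (Spec.map (i.stalkMap x))) _
      (isLocalizingImmersion_of_isOpenImmersion _) (hf.localMap x) hP
    rwa [he, IsIso.inv_hom_id_assoc] at h'
  · rw [he]
    exact hloc _ _ (isLocalizingImmersion_of_isOpenImmersion _) (hh.localMap _) hP

/-- Factorizations with the property `P`, for morphisms having it at all points. -/
lemma exists_factorization (hloc : IsStableUnderLocalization P)
    (hcheck : ∀ {X Y : Scheme.{u}} (f : X ⟶ Y), Se f → IsFiniteType f → IsCheckedLocally P f)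
    (hopen : ∀ {X Y : Scheme.{u}} (f : X ⟶ Y), Se f → IsFiniteType f → HasOpenLocus P f)
    (f : X ⟶ Y) (hf : Se f) :
    HasOpenLocus P f ∧ ((∀ x, P (localMap f x)) → ∃ (Z : Scheme.{u}) (i : X ⟶ Z) (h : Z ⟶ Y),
      i ≫ h = f ∧ IsLocalizingImmersion i ∧ Se h ∧ IsFiniteType h ∧ P h) := by
  have := hf.noetherian_source
  have := hf.noetherian_target
  have := hf.separated
  have hQ := localizationClass_localizing.{u}
  obtain ⟨Z, i, h, rfl, hic, hinj, _, _, _⟩ :=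
    HasFactorization.of_hasCharts f hf.essFiniteType.hasCharts
  have hnZ : AlgebraicGeometry.IsNoetherian Z := isNoetherian_of_finiteType h
  have hi := hic.isLocalizingImmersion hinj
  have hh : Se h := .of_hasCharts (hasCharts_essFiniteType_of_locallyOfFiniteType h)
  have hiff := localMap_comp_iff hloc i h hi hic hf hh
  -- Restricting `h` to its `P`-locus is what makes (β)(i) applicable.
  let O : Z.Opens := ⟨{z | P (localMap h z)}, hopen h hh ⟨inferInstance, inferInstance⟩⟩
  refine ⟨?_, fun hP ↦ ?_⟩
  · have : {x | P (localMap (i ≫ h) x)} = i ⁻¹' O := Set.ext hiff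
    rw [HasOpenLocus, this]
    exact O.2.preimage i.continuous
  have hO : Set.range i ⊆ Set.range O.ι := by
    rw [Scheme.Opens.range_ι]
    rintro _ ⟨x, rfl⟩
    exact (hiff x).mp (hP x)
  obtain ⟨l, hl⟩ : ∃ l : X ⟶ O, l ≫ O.ι = i :=
    ⟨IsOpenImmersion.lift O.ι i hO, IsOpenImmersion.lift_fac _ _ _⟩
  have hnO := isNoetherian_of_isOpenImmersion O.ι
  have hOh : Se (O.ι ≫ h) := .of_hasCharts (hasCharts_essFiniteType_of_locallyOfFiniteType _)
  have hfin : IsFiniteType (O.ι ≫ h) := ⟨inferInstance, inferInstance⟩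
  have hlc : HasLocalizingCharts l := .of_comp_isOpenImmersion hQ l O.ι (by rwa [hl])
  refine ⟨O, l, O.ι ≫ h, by rw [reassoc_of% hl], hlc.isLocalizingImmersion fun a b hab ↦ ?_,
    hOh, hfin, hcheck _ hOh hfin fun o ↦ ?_⟩
  · exact hinj (by rw [← hl, Scheme.Hom.comp_apply, Scheme.Hom.comp_apply, hab])
  · rw [localMap_comp_iff hloc O.ι h (isLocalizingImmersion_of_isOpenImmersion _)
      (.of_isOpenImmersion hQ _) hOh hh]
    exact o.2

end EssFiniteType

theorem mainTheorem10 (P : MorphismProperty Scheme.{u})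
    (hloc : EssFiniteType.IsStableUnderLocalization P)
    (hcheck : ∀ {X Y : Scheme.{u}} (f : X ⟶ Y), EssFiniteType.Se f →
      EssFiniteType.IsFiniteType f → EssFiniteType.IsCheckedLocally P f)
    (hopen : ∀ {X Y : Scheme.{u}} (f : X ⟶ Y), EssFiniteType.Se f →
      EssFiniteType.IsFiniteType f → EssFiniteType.HasOpenLocus P f) :
    (∀ {X Y : Scheme.{u}} (f : X ⟶ Y), EssFiniteType.Se f →
      EssFiniteType.IsCheckedLocally P f ∧ EssFiniteType.HasOpenLocus P f) ∧
    (∀ {X Y : Scheme.{u}} (f : X ⟶ Y), EssFiniteType.Se f → P f →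
      ∃ (Z : Scheme.{u}) (i : X ⟶ Z) (h : Z ⟶ Y), i ≫ h = f ∧
        EssFiniteType.IsLocalizingImmersion i ∧ EssFiniteType.Se h ∧
        EssFiniteType.IsFiniteType h ∧ P h) := by
  refine ⟨fun f hf ↦ ?_, fun f hf hP ↦ ?_⟩
  · obtain ⟨ho, hfac⟩ := EssFiniteType.exists_factorization hloc hcheck hopen f hf
    refine ⟨fun hP ↦ ?_, ho⟩
    obtain ⟨Z, i, h, rfl, hi, hh, -, hPh⟩ := hfac hP
    exact hloc i h hi hh hPh
  · have := hf.noetherian_source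
    exact (EssFiniteType.exists_factorization hloc hcheck hopen f hf).2 fun x ↦
      hloc _ f (EssFiniteType.isLocalizingImmersion_fromSpecStalk x) hf hP
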